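/- Let $m>0$, let $\mathcal M=\mathbb R^{1+3}$ be Minkowski spacetime with $\square=-\partial_t^2+\Delta$, and let $\mathcal M_5=\mathcal M\times\mathbb R$ be five-dimensional Minkowski spacetime with $\tilde\square=\square+\partial_z^2$. For either spacetime $X$, let $C^\infty_{\rm pc}(X)$ be the space of smooth complex-valued functions whose support $S$ is past-compact, i.e. $S\cap J^-(p)$ is compact for every $p\in X$. Let $\mathsf G^M_{\rm ret}\colon C^\infty_{\rm pc}(\mathcal M)\to C^\infty_{\rm pc}(\mathcal M)$ and $\tilde{\mathsf G}_{\rm ret}\colon C^\infty_{\rm pc}(\mathcal M_5)\to C^\infty_{\rm pc}(\mathcal M_5)$ be the retarded propagators of $\square-M$ and $\tilde\square-4m^2$: they map a source $\phi$ to the unique past-compact smooth solution $\psi$ of $(\square-M)\psi=\phi$, respectively of $(\tilde\square-4m^2)\psi=\phi$. For $\phi\in C^\infty_{\rm pc}(\mathcal M)$ and $g\in L^2(\mathbb R)$ the function $\tilde{\mathsf G}_{\rm ret}(\phi\otimes g)$ on $\mathcal M_5$ is defined by continuous extension: its value at a point is the limit of the values of $\tilde{\mathsf G}_{\rm ret}(\phi\otimes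 h)$ as $h\in C^\infty_c(\mathbb R)$ tends to $g$ in $L^2(\mathbb R)$. Put $$\rho(M)=\frac1{16\pi^2}\sqrt{1-\frac{4m^2}{M}}\,\frac1M\quad(M\ge 4m^2),\qquad \check\rho(z)=\int_{\mathbb R}\rho(p^2+4m^2)\,|p|\,e^{{\rm i}pz}\,dp ,$$ the latter in the sense of the Fourier–Plancherel transform on $L^2(\mathbb R)$, and let $(\iota_{\mathcal M}u)(x)=u(x,0)$ for functions $u$ on $\mathcal M_5$. Finally let $$\mathcal K_0(\phi)=\square\int_{4m^2}^\infty\rho(M)\,\mathsf G^M_{\rm ret}(\phi)\,dM .$$ Then for every $\phi\in C^\infty_{\rm pc}(\mathcal M)$ the following hold. There is a unique past-compact smooth solution of $(\square-M)\psi=\phi$ for every $M\ge 4m^2$, and of $(\tilde\square-4m^2)\Psi=\phi\otimes h$ for every $h\in C^\infty_c(\mathbb R)$. The limit defining $\tilde{\mathsf G}_{\rm ret}(\phi\otimes\check\rho)$ exists at every point of $\mathcal M_5$ and is a continuous function on $\mathcal M_5$. The integral $\int_{4m^2}^\infty\rho(M)\mathsf G^M_{\rm ret}(\phi)\,dM$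 converges absolutely at every point of $\mathcal M$, defines a function in $C^\infty_{\rm pc}(\mathcal M)$, and $$\int_{4m^2}^\infty\rho(M)\,\mathsf G^M_{\rm ret}(\phi)\,dM=\iota_{\mathcal M}\tilde{\mathsf G}_{\rm ret}(\phi\otimes\check\rho).$$ Consequently $\square\phi\in C^\infty_{\rm pc}(\mathcal M)$ satisfies $$\mathcal K_0(\phi)=\iota_{\mathcal M}\tilde{\mathsf G}_{\rm ret}(\square\phi\otimes\check\rho).$$ -/

import Mathlib

open MeasureTheory Filter Topology Set
open scoped ContDiff FourierTransform Laplacian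

noncomputable section

/-! Minkowski spacetime with spatial slices the Euclidean space `E` is `ℝ × E`, with points
`(t, x)`, metric `-dt² + dx²` and time orientation given by `t`. -/

section Minkowski

variable {E : Type*} [NormedAddCommGroup E] [InnerProductSpace ℝ E] [FiniteDimensional ℝ E]

/-- The causal past `J⁻(p)` of an event `p = (t, x)` of Minkowski spacetime. -/
def causalPast (p : ℝ × E) : Set (ℝ × E) :=
  {q | ‖p.2 - q.2‖ ≤ p.1 - q.1}

/-- The space of past-compact smooth functions: smooth functions whose support meets the causal
past of every event in a compact set. -/
def IsPastCompactSmooth (u : ℝ × E → ℂ) : Prop :=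
  ContDiff ℝ ∞ u ∧ ∀ p : ℝ × E, IsCompact (causalPast p ∩ tsupport u)

/-- The d'Alembert operator `□ = -∂ₜ² + Δ`. -/
def dAlembertian (u : ℝ × E → ℂ) (p : ℝ × E) : ℂ :=
  -(iteratedDeriv 2 (fun s : ℝ => u (s, p.2)) p.1) + (Δ (fun y : E => u (p.1, y))) p.2

/-- `ψ` is a past-compact smooth solution of the Klein-Gordon equation `(□ - M) ψ = φ`, with
squared mass `M`. -/
def IsRetardedSolution (M : ℝ) (φ ψ : ℝ × E → ℂ) : Prop :=
  IsPastCompactSmooth ψ ∧ ∀ p, dAlembertian ψ p - (M : ℂ) * ψ p = φ p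

open Classical in
/-- The retarded propagator `G_ret^M` of the Klein-Gordon operator `□ - M`: it sends a past-compact
smooth source `φ` to the unique past-compact smooth solution `ψ` of `(□ - M) ψ = φ`. -/
def retardedPropagator (M : ℝ) (φ : ℝ × E → ℂ) : ℝ × E → ℂ :=
  if h : ∃! ψ, IsRetardedSolution M φ ψ then h.choose else 0

end Minkowski

/-- Three-dimensional Euclidean space. -/
abbrev Space3 : Type := EuclideanSpace ℝ (Fin 3)

/-- The four-dimensional Euclidean space `ℝ³ × ℝ` (with the Euclidean norm). -/
abbrev Space4 : Type := WithLp 2 (Space3 × ℝ)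

/-- Four-dimensional Minkowski spacetime `𝓜`. -/
abbrev Mink4 : Type := ℝ × Space3

/-- Five-dimensional Minkowski spacetime `𝓜₅ = 𝓜 × ℝ`. -/
abbrev Mink5 : Type := ℝ × Space4

/-- The event `((t, x), z) ∈ 𝓜 × ℝ`, as an element of `𝓜₅`. -/
def event5 (p : Mink4) (z : ℝ) : Mink5 := (p.1, WithLp.toLp 2 (p.2, z))

/-- The function `(φ ⊗ h)(p, z) = φ(p) h(z)` on `𝓜₅`. -/
def tensorFun (φ : Mink4 → ℂ) (h : ℝ → ℂ) : Mink5 → ℂ :=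
  fun q => φ (q.1, q.2.fst) * h q.2.snd

/-- The restriction `ι_𝓜` of functions on `𝓜₅` to `𝓜 ≅ 𝓜 × {0}`. -/
def restrictZero (u : Mink5 → ℂ) : Mink4 → ℂ :=
  fun p => u (event5 p 0)

/-- The filter of test functions `h ∈ C_c^∞(ℝ)` converging to `g` in `L²(ℝ)`. -/
def testFunNhds (g : Lp ℂ 2 (volume : Measure ℝ)) : Filter (ℝ → ℂ) :=
  comap (fun h : ℝ → ℂ => eLpNorm (fun z => h z - g z) 2 volume) (𝓝 0) ⊓
    𝓟 {h | ContDiff ℝ ∞ h ∧ HasCompactSupport h}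

/-- The extension of the five-dimensional retarded propagator of `□̃ - M` to `φ ⊗ g` with
`φ` past-compact smooth and `g ∈ L²(ℝ)`, by continuity and density of `C_c^∞(ℝ)` in `L²(ℝ)`:
its value at a point is the limit of the values of `G_ret (φ ⊗ h)` as `h → g` in `L²(ℝ)`. -/
def retardedPropagatorL2 (M : ℝ) (φ : Mink4 → ℂ) (g : Lp ℂ 2 (volume : Measure ℝ)) :
    Mink5 → ℂ :=
  fun q => limUnder (testFunNhds g) (fun h => retardedPropagator M (tensorFun φ h) q)

/-- The density `ρ(M) = (1 / 16π²) √(1 - 4m² / M) / M`. -/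
def rhoDensity (m M : ℝ) : ℝ :=
  1 / (16 * Real.pi ^ 2) * Real.sqrt (1 - 4 * m ^ 2 / M) * (1 / M)

/-- The function `p ↦ ρ(p² + 4m²) |p|`. -/
def rhoSymbol (m p : ℝ) : ℝ :=
  rhoDensity m (p ^ 2 + 4 * m ^ 2) * |p|

theorem rhoSymbol_sq_le {m : ℝ} (hm : 0 < m) (p : ℝ) :
    (rhoSymbol m p) ^ 2 ≤
      (1 / (16 * Real.pi ^ 2)) ^ 2 * (1 + 1 / (4 * m ^ 2)) * (1 + p ^ 2)⁻¹ := by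
  have hP : 0 < p ^ 2 + 4 * m ^ 2 := by positivity
  have hs : 1 - 4 * m ^ 2 / (p ^ 2 + 4 * m ^ 2) = p ^ 2 / (p ^ 2 + 4 * m ^ 2) := by
    field_simp; ring
  have h0 : 0 ≤ p ^ 2 / (p ^ 2 + 4 * m ^ 2) := by positivity
  have h1 : p ^ 2 / (p ^ 2 + 4 * m ^ 2) ≤ 1 := by
    rw [div_le_one hP]; nlinarith [sq_nonneg m]
  have key : (rhoSymbol m p) ^ 2 = (1 / (16 * Real.pi ^ 2)) ^ 2 *
      ((p ^ 2 / (p ^ 2 + 4 * m ^ 2)) * (p ^ 2 / (p ^ 2 + 4 * m ^ 2)) *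
        (1 / (p ^ 2 + 4 * m ^ 2))) := by
    unfold rhoSymbol rhoDensity
    rw [hs, mul_pow, mul_pow, mul_pow, Real.sq_sqrt h0, sq_abs]
    ring
  have h2 : (p ^ 2 / (p ^ 2 + 4 * m ^ 2)) * (p ^ 2 / (p ^ 2 + 4 * m ^ 2)) ≤ 1 :=
    mul_le_one₀ h1 h0 h1
  have h3 : (1 + 1 / (4 * m ^ 2)) * (p ^ 2 + 4 * m ^ 2) =
      p ^ 2 + 4 * m ^ 2 + p ^ 2 / (4 * m ^ 2) + 1 := by
    field_simp
    ring
  have h4 : 0 ≤ p ^ 2 / (4 * m ^ 2) := by positivity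
  have h5 : 1 / (p ^ 2 + 4 * m ^ 2) ≤ (1 + 1 / (4 * m ^ 2)) * (1 + p ^ 2)⁻¹ := by
    rw [← div_eq_mul_inv, div_le_div_iff₀ hP (by positivity), h3]
    nlinarith [sq_nonneg m]
  have h6 : (p ^ 2 / (p ^ 2 + 4 * m ^ 2)) * (p ^ 2 / (p ^ 2 + 4 * m ^ 2)) *
      (1 / (p ^ 2 + 4 * m ^ 2)) ≤ (1 + 1 / (4 * m ^ 2)) * (1 + p ^ 2)⁻¹ :=
    (mul_le_of_le_one_left (by positivity) h2).trans h5
  rw [key, mul_assoc ((1 / (16 * Real.pi ^ 2)) ^ 2) (1 + 1 / (4 * m ^ 2))]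
  exact mul_le_mul_of_nonneg_left h6 (by positivity)

/-- The rescaling `q ↦ 2π ρ(p² + 4m²) |p|`, `p = 2π q`, is square integrable. -/
theorem memLp_rhoSymbol {m : ℝ} (hm : 0 < m) :
    MemLp (fun q : ℝ => ((2 * Real.pi * rhoSymbol m (2 * Real.pi * q) : ℝ) : ℂ)) 2
      (volume : Measure ℝ) := by
  have hmeas : Measurable (rhoSymbol m) := by
    unfold rhoSymbol rhoDensity
    fun_prop
  have h1 : MemLp (rhoSymbol m) 2 (volume : Measure ℝ) := by
    rw [memLp_two_iff_integrable_sq hmeas.aestronglyMeasurable]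
    refine (integrable_inv_one_add_sq.const_mul
      ((1 / (16 * Real.pi ^ 2)) ^ 2 * (1 + 1 / (4 * m ^ 2)))).mono'
      (hmeas.pow_const 2).aestronglyMeasurable ?_
    filter_upwards with p
    rw [Real.norm_of_nonneg (sq_nonneg _)]
    exact rhoSymbol_sq_le hm p
  have h2 : MemLp (fun q : ℝ => 2 * Real.pi * rhoSymbol m (2 * Real.pi * q)) 2
      (volume : Measure ℝ) := by
    have hm2 : Measurable (fun q : ℝ => rhoSymbol m (2 * Real.pi * q)) :=
      hmeas.comp (measurable_const_mul _)
    refine MemLp.const_mul ?_ _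
    rw [memLp_two_iff_integrable_sq hm2.aestronglyMeasurable]
    rw [memLp_two_iff_integrable_sq hmeas.aestronglyMeasurable] at h1
    exact h1.comp_mul_left' (R := 2 * Real.pi) (by positivity)
  exact h2.ofReal

/-- The inverse Fourier-Plancherel transform `ρ̌(z) = ∫ ρ(p² + 4m²) |p| e^{ipz} dp` in `L²(ℝ)`.
Mathlib's inverse transform on `L²` extends `(𝓕⁻ f)(z) = ∫ f(q) e^{2πiqz} dq`; the substitution
`p = 2π q` turns the integral above into this form, with `f(q) = 2π ρ(p² + 4m²) |p|`. -/
def rhoCheck (m : ℝ) (hm : 0 < m) : Lp ℂ 2 (volume : Measure ℝ) :=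
  𝓕⁻ ((memLp_rhoSymbol hm).toLp _)

/-- The function `∫_{4m²}^∞ ρ(M) G_ret^M(φ) dM` on `𝓜`. -/
def spectralIntegral (m : ℝ) (φ : Mink4 → ℂ) : Mink4 → ℂ :=
  fun p => ∫ M in Ioi (4 * m ^ 2), (rhoDensity m M : ℂ) * retardedPropagator M φ p

/-- The nonlocal operator `𝓚₀[φ] = □ ∫_{4m²}^∞ ρ(M) G_ret^M(φ) dM`. -/
def nonlocalK0 (m : ℝ) (φ : Mink4 → ℂ) : Mink4 → ℂ :=
  dAlembertian (spectralIntegral m φ)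

end

open MeasureTheory Filter Topology Set
open scoped ContDiff FourierTransform Laplacian

noncomputable section

/-! Fourier analysis in the fifth coordinate `z` reduces the five-dimensional equation to
four-dimensional ones. For a plane wave, `∂_z²` acts as multiplication by `-(2πp)²`, so `e^{2πipz}
G^M(φ)(x)` with `M = 4m² + (2πp)²` solves the five-dimensional equation with source `φ(x)
e^{2πipz}`. Superposing these modes gives `G̃(φ ⊗ h)(x, z) = ∫ ĥ(p) e^{2πipz} G^M(φ)(x) dp` for
Schwartz `h` (`retardedPropagator_tensorFun`).

The extension to `L²` rests on decay in the mass. If `ψ = G^M(φ)`, then `Mψ = □ψ - φ = G^M(□φ) - φ`,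
and the right-hand side is locally bounded uniformly in `M`; hence `G^M(φ) = O(1/M)`
(`retardedPropagator_locally_le_div`). At a fixed point the mode is therefore square integrable in
`p`, and by Plancherel the superposition is continuous in `h` for the `L²` norm
(`tendsto_retardedPropagator_tensorFun`). For `h → ρ̌` the amplitude becomes the symbol `2π ρ((2πp)²
+ 4m²) |2πp|`. At `z = 0`, evenness and the substitution `M = (2πp)² + 4m²` turn the integral over
`p` into the integral over `M` (`modeIntegral_event5`). The same decay makes the integrand over `M`
of order `M⁻²`, together with all its derivatives in the spacetime point, so `□` passes under the
integral and onto `φ`, which gives the second identity.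

The propagators themselves are constructed as follows. Writing `u = eᵗ v` replaces `∂ₜ` by `∂ₜ + 1`,
and the resulting symbol has modulus at least `1` everywhere. Dividing by it preserves Schwartz
functions and yields solutions for test-function sources, bounded uniformly in `M`. An energy
estimate in past light cones (`eq_zero_of_kleinGordon_real`) shows that these solutions vanish
before the source; it also gives uniqueness and dependence on the causal past only, so that
solutions for general past-compact sources can be glued from local ones. -/

/-- The derivative of `u` in the constant direction `v`. -/
def dirDeriv {X F : Type*} [NormedAddCommGroup X] [NormedSpace ℝ X] [NormedAddCommGroup F]
    [NormedSpace ℝ F] (v : X) (u : X → F) : X → F :=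
  fun p => fderiv ℝ u p v

/-! ### Calculus of derivatives in constant directions -/

section DirDeriv

variable {X F : Type*} [NormedAddCommGroup X] [NormedSpace ℝ X] [NormedAddCommGroup F]
  [NormedSpace ℝ F]

theorem ContDiff.dirDeriv {u : X → F} (hu : ContDiff ℝ ∞ u) (v : X) :
    ContDiff ℝ ∞ (dirDeriv v u) :=
  (hu.fderiv_right (m := ∞) (by simp)).clm_apply contDiff_const

theorem ContDiff.differentiable_infty {u : X → F} (hu : ContDiff ℝ ∞ u) : Differentiable ℝ u :=
  hu.differentiable (by simp)

theorem dirDeriv_comm {u : X → F} (hu : ContDiff ℝ ∞ u) (v w : X) :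
    dirDeriv v (dirDeriv w u) = dirDeriv w (dirDeriv v u) := by
  have key : ∀ (a b : X) (p : X), dirDeriv a (dirDeriv b u) p = fderiv ℝ (fderiv ℝ u) p a b := by
    intro a b p
    have hd : DifferentiableAt ℝ (fderiv ℝ u) p :=
      ((hu.fderiv_right (m := ∞) (by simp)).differentiable_infty) p
    unfold dirDeriv
    rw [fderiv_clm_apply hd (differentiableAt_const b)]
    simp
  ext p
  rw [key, key]
  have := ((contDiff_infty.1 hu 2).contDiffAt (x := p)).isSymmSndFDerivAt (by simp)
  exact this v w

theorem dirDeriv_add {u w : X → F} (hu : Differentiable ℝ u) (hw : Differentiable ℝ w) (v : X) :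
    dirDeriv v (fun p => u p + w p) = fun p => dirDeriv v u p + dirDeriv v w p := by
  ext p
  simp [dirDeriv, fderiv_fun_add (hu p) (hw p)]

theorem dirDeriv_sub {u w : X → F} (hu : Differentiable ℝ u) (hw : Differentiable ℝ w) (v : X) :
    dirDeriv v (fun p => u p - w p) = fun p => dirDeriv v u p - dirDeriv v w p := by
  ext p
  simp [dirDeriv, fderiv_fun_sub (hu p) (hw p)]

theorem dirDeriv_sum {ι : Type*} {s : Finset ι} {u : ι → X → F}
    (hu : ∀ i ∈ s, Differentiable ℝ (u i)) (v : X) :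
    dirDeriv v (fun p => ∑ i ∈ s, u i p) = fun p => ∑ i ∈ s, dirDeriv v (u i) p := by
  ext p
  simp only [dirDeriv]
  rw [fderiv_fun_sum (fun i hi => hu i hi p)]
  simp

theorem dirDeriv_neg (u : X → F) (v : X) :
    dirDeriv v (fun p => -u p) = fun p => -dirDeriv v u p := by
  ext p
  simp [dirDeriv, fderiv_fun_neg]

theorem dirDeriv_const_mul {u : X → ℂ} (hu : Differentiable ℝ u) (c : ℂ) (v : X) :
    dirDeriv v (fun p => c * u p) = fun p => c * dirDeriv v u p := by
  ext p
  simp [dirDeriv, fderiv_const_mul (hu p)]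

theorem dirDeriv_mul {A : Type*} [NormedCommRing A] [NormedAlgebra ℝ A] {u w : X → A}
    (hu : Differentiable ℝ u) (hw : Differentiable ℝ w) (v : X) :
    dirDeriv v (fun p => u p * w p) = fun p => u p * dirDeriv v w p + dirDeriv v u p * w p := by
  ext p
  simp only [dirDeriv]
  rw [fderiv_fun_mul (hu p) (hw p)]
  simp [mul_comm]

theorem dirDeriv_clm_comp {G : Type*} [NormedAddCommGroup G] [NormedSpace ℝ G] (L : F →L[ℝ] G)
    {u : X → F} (hu : Differentiable ℝ u) (v : X) :
    dirDeriv v (fun p => L (u p)) = fun p => L (dirDeriv v u p) := by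
  ext p
  have := (L.hasFDerivAt.comp p (hu p).hasFDerivAt).fderiv
  simp only [dirDeriv]
  change fderiv ℝ (L ∘ u) p v = _
  rw [this]; rfl

theorem dirDeriv_comp_clm {Y : Type*} [NormedAddCommGroup Y] [NormedSpace ℝ Y] (L : Y →L[ℝ] X)
    {u : X → F} (hu : Differentiable ℝ u) (v : Y) :
    dirDeriv v (fun p => u (L p)) = fun p => dirDeriv (L v) u (L p) := by
  ext p
  have := ((hu (L p)).hasFDerivAt.comp p L.hasFDerivAt).fderiv
  simp only [dirDeriv]
  change fderiv ℝ (u ∘ L) p v = _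
  rw [this]; rfl

theorem Filter.EventuallyEq.dirDeriv {u w : X → F} {p : X} (h : u =ᶠ[𝓝 p] w) (v : X) :
    dirDeriv v u =ᶠ[𝓝 p] dirDeriv v w :=
  h.fderiv.mono fun _ hq => congrArg (fun L : X →L[ℝ] F => L v) hq

theorem dirDeriv_eq_zero_of_eventually {u : X → F} {p : X} (h : ∀ᶠ q in 𝓝 p, u q = 0) (v : X) :
    ∀ᶠ q in 𝓝 p, dirDeriv v u q = 0 := by
  have h' : u =ᶠ[𝓝 p] fun _ => 0 := h
  filter_upwards [h'.dirDeriv v] with q hq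
  rw [hq]; simp [dirDeriv]

end DirDeriv

/-! ### The d'Alembertian on smooth functions -/

section DAlembertian

variable {E : Type*} [NormedAddCommGroup E] [InnerProductSpace ℝ E] [FiniteDimensional ℝ E]

/-- Second derivatives along slices are iterated constant-direction derivatives on spacetime, and
these commute. The basis is left free so that one adapted to `𝓜 × ℝ` can be chosen later. -/
theorem dAlembertian_eq {ι : Type*} [Fintype ι] (b : OrthonormalBasis ι ℝ E) {u : ℝ × E → ℂ}
    (hu : ContDiff ℝ ∞ u) (p : ℝ × E) :
    dAlembertian u p = -dirDeriv (1, 0) (dirDeriv (1, 0) u) p +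
      ∑ i, dirDeriv (0, b i) (dirDeriv (0, b i) u) p := by
  have ht : ∀ {w : ℝ × E → ℂ}, ContDiff ℝ ∞ w → ∀ (x : E) (s : ℝ),
      deriv (fun s : ℝ => w (s, x)) s = dirDeriv (1, 0) w (s, x) := by
    intro w hw x s
    have h1 : HasDerivAt (fun s : ℝ => (s, x)) ((1 : ℝ), (0 : E)) s :=
      (hasDerivAt_id s).prodMk (hasDerivAt_const s x)
    exact ((hw.differentiable_infty (s, x)).hasFDerivAt.comp_hasDerivAt s h1).deriv
  have hx : ∀ {w : ℝ × E → ℂ}, ContDiff ℝ ∞ w → ∀ (t : ℝ) (x e : E),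
      fderiv ℝ (fun y : E => w (t, y)) x e = dirDeriv (0, e) w (t, x) := by
    intro w hw t x e
    have h1 : HasFDerivAt (fun y : E => (t, y)) (ContinuousLinearMap.inr ℝ ℝ E) x :=
      hasFDerivAt_prodMk_right t x
    have h2 := ((hw.differentiable_infty (t, x)).hasFDerivAt.comp x h1).fderiv
    change fderiv ℝ (w ∘ fun y : E => (t, y)) x e = _
    rw [h2]; simp [dirDeriv]
  have hslice : ∀ t, ContDiff ℝ ∞ (fun y : E => u (t, y)) := fun t =>
    hu.comp (contDiff_const.prodMk contDiff_id)
  obtain ⟨t, x⟩ := p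
  unfold dAlembertian
  congr 1
  · rw [iteratedDeriv_succ, iteratedDeriv_one]
    congr 1
    have : deriv (fun s : ℝ => u (s, x)) = fun s => dirDeriv (1, 0) u (s, x) :=
      funext fun s => ht hu x s
    simp only [this]
    exact ht (hu.dirDeriv _) x t
  · rw [InnerProductSpace.laplacian_eq_iteratedFDeriv_orthonormalBasis _ b]
    refine Finset.sum_congr rfl fun i _ => ?_
    rw [iteratedFDeriv_two_apply]
    simp only [Matrix.cons_val_zero, Matrix.cons_val_one]
    have hd : DifferentiableAt ℝ (fderiv ℝ fun y : E => u (t, y)) x :=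
      ((hslice t).fderiv_right (m := ∞) (by simp)).differentiable_infty x
    have h3 : fderiv ℝ (fderiv ℝ fun y : E => u (t, y)) x (b i) (b i) =
        fderiv ℝ (fun y => fderiv ℝ (fun y : E => u (t, y)) y (b i)) x (b i) := by
      rw [fderiv_clm_apply hd (differentiableAt_const _)]
      simp
    rw [h3]
    have : (fun y => fderiv ℝ (fun y : E => u (t, y)) y (b i)) =
        fun y => dirDeriv (0, b i) u (t, y) := funext fun y => hx hu t y (b i)
    rw [this]
    exact hx (hu.dirDeriv _) t x (b i)

theorem ContDiff.dAlembertian {u : ℝ × E → ℂ} (hu : ContDiff ℝ ∞ u) :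
    ContDiff ℝ ∞ (dAlembertian u) := by
  have : _root_.dAlembertian u = fun p => -_root_.dirDeriv (1, 0) (_root_.dirDeriv (1, 0) u) p +
      ∑ i, _root_.dirDeriv (0, stdOrthonormalBasis ℝ E i)
        (_root_.dirDeriv (0, stdOrthonormalBasis ℝ E i) u) p :=
    funext fun p => dAlembertian_eq _ hu p
  rw [this]
  exact ((hu.dirDeriv _).dirDeriv _).neg.add
    (ContDiff.sum fun i _ => (hu.dirDeriv _).dirDeriv _)

theorem dAlembertian_add {u w : ℝ × E → ℂ} (hu : ContDiff ℝ ∞ u) (hw : ContDiff ℝ ∞ w)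
    (p : ℝ × E) :
    dAlembertian (fun p => u p + w p) p = dAlembertian u p + dAlembertian w p := by
  rw [dAlembertian_eq (stdOrthonormalBasis ℝ E) (hu.add hw),
    dAlembertian_eq (stdOrthonormalBasis ℝ E) hu, dAlembertian_eq (stdOrthonormalBasis ℝ E) hw]
  simp only [dirDeriv_add hu.differentiable_infty hw.differentiable_infty,
    dirDeriv_add (hu.dirDeriv _).differentiable_infty (hw.dirDeriv _).differentiable_infty,
    Finset.sum_add_distrib]
  ring

theorem dAlembertian_const_mul {u : ℝ × E → ℂ} (hu : ContDiff ℝ ∞ u) (c : ℂ) (p : ℝ × E) :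
    dAlembertian (fun p => c * u p) p = c * dAlembertian u p := by
  rw [dAlembertian_eq (stdOrthonormalBasis ℝ E) (contDiff_const.mul hu),
    dAlembertian_eq (stdOrthonormalBasis ℝ E) hu]
  simp only [dirDeriv_const_mul hu.differentiable_infty,
    dirDeriv_const_mul (hu.dirDeriv _).differentiable_infty, ← Finset.mul_sum]
  ring

theorem dAlembertian_sub {u w : ℝ × E → ℂ} (hu : ContDiff ℝ ∞ u) (hw : ContDiff ℝ ∞ w)
    (p : ℝ × E) :
    dAlembertian (fun p => u p - w p) p = dAlembertian u p - dAlembertian w p := by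
  have h1 := dAlembertian_add hu (contDiff_const.mul hw : ContDiff ℝ ∞ fun p => (-1 : ℂ) * w p) p
  rw [dAlembertian_const_mul hw] at h1
  simpa [sub_eq_add_neg] using h1

theorem dAlembertian_congr {u w : ℝ × E → ℂ} {p : ℝ × E} (hu : ContDiff ℝ ∞ u)
    (hw : ContDiff ℝ ∞ w) (h : u =ᶠ[𝓝 p] w) : dAlembertian u p = dAlembertian w p := by
  rw [dAlembertian_eq (stdOrthonormalBasis ℝ E) hu, dAlembertian_eq (stdOrthonormalBasis ℝ E) hw,
    ((h.dirDeriv (1, 0)).dirDeriv (1, 0)).eq_of_nhds]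
  congr 1
  exact Finset.sum_congr rfl fun i _ => ((h.dirDeriv _).dirDeriv _).eq_of_nhds

theorem dirDeriv_dAlembertian {u : ℝ × E → ℂ} (hu : ContDiff ℝ ∞ u) (v : ℝ × E) :
    dirDeriv v (dAlembertian u) = dAlembertian (dirDeriv v u) := by
  have hs : ∀ w, ContDiff ℝ ∞ (dirDeriv w (dirDeriv w u)) := fun w => (hu.dirDeriv w).dirDeriv w
  have hc : ∀ w, dirDeriv v (dirDeriv w (dirDeriv w u)) = dirDeriv w (dirDeriv w (dirDeriv v u)) :=
    fun w => by rw [dirDeriv_comm (hu.dirDeriv w), dirDeriv_comm hu v w]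
  ext p
  rw [show dAlembertian u = _ from funext fun p => dAlembertian_eq (stdOrthonormalBasis ℝ E) hu p,
    dAlembertian_eq (stdOrthonormalBasis ℝ E) (hu.dirDeriv v),
    dirDeriv_add (hs _).neg.differentiable_infty
      (ContDiff.sum fun i _ => hs _).differentiable_infty,
    dirDeriv_neg, dirDeriv_sum fun i _ => (hs _).differentiable_infty]
  simp only [hc]

end DAlembertian

/-! ### Past-compact smooth functions -/

section PastCompact

variable {E : Type*} [NormedAddCommGroup E]

theorem causalPast_trans {p q r : ℝ × E} (hq : q ∈ causalPast p) (hr : r ∈ causalPast q) :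
    r ∈ causalPast p := by
  simp only [causalPast, mem_ofPred_eq] at *
  calc ‖p.2 - r.2‖ = ‖(p.2 - q.2) + (q.2 - r.2)‖ := by congr 1; abel
    _ ≤ _ := norm_add_le _ _
    _ ≤ _ := by linarith

theorem causalPast_time_le {p q : ℝ × E} (hq : q ∈ causalPast p) : q.1 ≤ p.1 := by
  have : ‖p.2 - q.2‖ ≤ p.1 - q.1 := hq
  linarith [norm_nonneg (p.2 - q.2)]

theorem isClosed_causalPast (p : ℝ × E) : IsClosed (causalPast p) :=
  isClosed_le (by fun_prop) (by fun_prop)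

/-- Events near the causal past of `p` are in the causal past of a slightly later event. -/
theorem causalPast_eventually {p q : ℝ × E} (hq : q ∈ causalPast p) {δ : ℝ} (hδ : 0 < δ) :
    ∀ᶠ r in 𝓝 q, r ∈ causalPast (p.1 + δ, p.2) := by
  have ho : IsOpen {r : ℝ × E | ‖p.2 - r.2‖ < p.1 + δ - r.1} :=
    isOpen_lt (by fun_prop) (by fun_prop)
  have hm : q ∈ {r : ℝ × E | ‖p.2 - r.2‖ < p.1 + δ - r.1} := by
    have : ‖p.2 - q.2‖ ≤ p.1 - q.1 := hq
    simp only [mem_ofPred_eq]; linarith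
  filter_upwards [ho.mem_nhds hm] with r hr
  exact le_of_lt hr

variable [InnerProductSpace ℝ E] [FiniteDimensional ℝ E]

theorem isCompact_causalPast_inter (p : ℝ × E) (T : ℝ) :
    IsCompact (causalPast p ∩ {q | T ≤ q.1}) := by
  refine Metric.isCompact_of_isClosed_isBounded
    ((isClosed_causalPast p).inter (isClosed_le continuous_const continuous_fst)) ?_
  refine ((Metric.isBounded_Icc T p.1).prod
    (Metric.isBounded_closedBall (x := p.2) (r := p.1 - T))).subset ?_
  rintro q ⟨hq, hT⟩
  refine ⟨⟨hT, causalPast_time_le hq⟩, ?_⟩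
  have : ‖p.2 - q.2‖ ≤ p.1 - q.1 := hq
  rw [Metric.mem_closedBall, dist_comm, dist_eq_norm]
  simp only [mem_ofPred_eq] at hT
  linarith

/-- A past cone cut off below at a fixed time is compact, so past-compactness only asks that `u`
vanish in each past cone before some time. This pointwise criterion replaces the topological support
in what follows. -/
theorem isCompact_causalPast_inter_tsupport_iff {u : ℝ × E → ℂ} :
    (∀ p : ℝ × E, IsCompact (causalPast p ∩ tsupport u)) ↔
      ∀ p : ℝ × E, ∃ T : ℝ, ∀ q ∈ causalPast p, q.1 < T → u q = 0 := by
  constructor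
  · intro h p
    obtain ⟨T, hT⟩ := ((h p).image continuous_fst).bddBelow
    refine ⟨T, fun q hq hlt => ?_⟩
    by_contra hne
    exact absurd (hT (mem_image_of_mem _ ⟨hq, subset_tsupport _ hne⟩)) (not_le.2 hlt)
  · intro h p
    -- Leaving the closed support requires vanishing on a neighbourhood; the tip is raised so that
    -- the larger cone contains one.
    obtain ⟨T, hT⟩ := h (p.1 + 1, p.2)
    refine (isCompact_causalPast_inter p T).of_isClosed_subset
      ((isClosed_causalPast p).inter (isClosed_tsupport u)) ?_
    rintro q ⟨hq, hs⟩
    refine ⟨hq, ?_⟩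
    by_contra hlt
    simp only [mem_ofPred_eq, not_le] at hlt
    refine notMem_tsupport_iff_eventuallyEq.2 ?_ hs
    filter_upwards [causalPast_eventually hq one_pos,
      (isOpen_lt continuous_fst continuous_const).mem_nhds hlt] with r hr hr2
    simpa using hT r hr hr2

theorem isPastCompactSmooth_iff {u : ℝ × E → ℂ} :
    IsPastCompactSmooth u ↔ ContDiff ℝ ∞ u ∧
      ∀ p : ℝ × E, ∃ T : ℝ, ∀ q ∈ causalPast p, q.1 < T → u q = 0 := by
  rw [IsPastCompactSmooth, isCompact_causalPast_inter_tsupport_iff]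

theorem IsPastCompactSmooth.dirDeriv {u : ℝ × E → ℂ} (hu : IsPastCompactSmooth u) (v : ℝ × E) :
    IsPastCompactSmooth (dirDeriv v u) := by
  rw [isPastCompactSmooth_iff] at *
  refine ⟨hu.1.dirDeriv v, fun p => ?_⟩
  obtain ⟨T, hT⟩ := hu.2 (p.1 + 1, p.2)
  refine ⟨T, fun q hq hlt => ?_⟩
  refine (dirDeriv_eq_zero_of_eventually ?_ v).self_of_nhds
  filter_upwards [causalPast_eventually hq one_pos,
      (isOpen_lt continuous_fst continuous_const).mem_nhds hlt] with r hr hr2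
  exact hT r hr hr2

theorem IsPastCompactSmooth.add {u w : ℝ × E → ℂ} (hu : IsPastCompactSmooth u)
    (hw : IsPastCompactSmooth w) : IsPastCompactSmooth (fun p => u p + w p) := by
  rw [isPastCompactSmooth_iff] at *
  refine ⟨hu.1.add hw.1, fun p => ?_⟩
  obtain ⟨T, hT⟩ := hu.2 p
  obtain ⟨S, hS⟩ := hw.2 p
  refine ⟨min T S, fun q hq hlt => ?_⟩
  rw [hT q hq (hlt.trans_le (min_le_left _ _)), hS q hq (hlt.trans_le (min_le_right _ _)), add_zero]

theorem IsPastCompactSmooth.const_mul {u : ℝ × E → ℂ} (hu : IsPastCompactSmooth u) (c : ℂ) :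
    IsPastCompactSmooth (fun p => c * u p) := by
  rw [isPastCompactSmooth_iff] at *
  refine ⟨contDiff_const.mul hu.1, fun p => ?_⟩
  obtain ⟨T, hT⟩ := hu.2 p
  exact ⟨T, fun q hq hlt => by rw [hT q hq hlt, mul_zero]⟩

theorem IsPastCompactSmooth.sub {u w : ℝ × E → ℂ} (hu : IsPastCompactSmooth u)
    (hw : IsPastCompactSmooth w) : IsPastCompactSmooth (fun p => u p - w p) := by
  simpa [sub_eq_add_neg] using hu.add (hw.const_mul (-1))

theorem isPastCompactSmooth_zero : IsPastCompactSmooth (fun _ : ℝ × E => (0 : ℂ)) :=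
  isPastCompactSmooth_iff.2 ⟨contDiff_const, fun _ => ⟨0, fun _ _ _ => rfl⟩⟩

theorem IsPastCompactSmooth.dAlembertian {u : ℝ × E → ℂ} (hu : IsPastCompactSmooth u) :
    IsPastCompactSmooth (dAlembertian u) := by
  refine isPastCompactSmooth_iff.2 ⟨hu.1.dAlembertian, fun p => ?_⟩
  obtain ⟨T, hT⟩ := (isPastCompactSmooth_iff.1 hu).2 (p.1 + 1, p.2)
  refine ⟨T, fun q hq hlt => ?_⟩
  have h0 : u =ᶠ[𝓝 q] fun _ => (0 : ℂ) := by
    filter_upwards [causalPast_eventually hq one_pos,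
      (isOpen_lt continuous_fst continuous_const).mem_nhds hlt] with r hr hr2
    exact hT r hr hr2
  rw [dAlembertian_congr hu.1 contDiff_const h0]
  have := dAlembertian_const_mul (contDiff_const : ContDiff ℝ ∞ fun _ : ℝ × E => (0 : ℂ)) 0 q
  simpa using this

end PastCompact

/-! ### A one-variable cutoff -/

section Weight

/-- A bounded `C¹` function vanishing on `(-∞, 0]` and strictly increasing on `[0, ∞)`. -/
def ramp (s : ℝ) : ℝ := (max s 0) ^ 2 / (1 + (max s 0) ^ 2)

/-- The derivative of `ramp`. -/
def rampDeriv (s : ℝ) : ℝ := 2 * max s 0 / (1 + (max s 0) ^ 2) ^ 2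

theorem hasDerivAt_max_zero_sq (s : ℝ) : HasDerivAt (fun s : ℝ => (max s 0) ^ 2) (2 * max s 0) s := by
  rcases lt_trichotomy s 0 with h | h | h
  · rw [max_eq_right h.le, mul_zero]
    refine (hasDerivAt_const s (0 : ℝ)).congr_of_eventuallyEq ?_
    filter_upwards [Iio_mem_nhds h] with x hx
    simp [max_eq_right (mem_Iio.1 hx).le]
  · subst h
    rw [max_self, mul_zero, hasDerivAt_iff_isLittleO_nhds_zero]
    have : (fun h : ℝ => h ^ 2) =o[𝓝 0] fun h : ℝ => h := by
      simpa using Asymptotics.isLittleO_pow_id (𝕜 := ℝ) one_lt_two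
    refine (Asymptotics.IsBigO.of_bound 1 (Eventually.of_forall fun x => ?_)).trans_isLittleO this
    simp only [zero_add, max_self, ne_eq, OfNat.ofNat_ne_zero, not_false_eq_true, zero_pow,
      sub_zero, smul_zero, norm_pow, Real.norm_eq_abs, one_mul, sq_abs]
    rcases le_total x 0 with hx | hx
    · rw [max_eq_right hx]; simpa using sq_nonneg x
    · rw [max_eq_left hx]
  · rw [max_eq_left h.le]
    refine HasDerivAt.congr_of_eventuallyEq (f := fun x => x ^ 2) (by simpa using hasDerivAt_pow 2 s) ?_
    filter_upwards [Ioi_mem_nhds h] with x hx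
    simp [max_eq_left (mem_Ioi.1 hx).le]

theorem hasDerivAt_ramp (s : ℝ) : HasDerivAt ramp (rampDeriv s) s := by
  have h := hasDerivAt_max_zero_sq s
  have h2 := h.div (h.const_add 1) (by positivity)
  refine h2.congr_deriv ?_
  unfold rampDeriv
  ring

theorem continuous_rampDeriv : Continuous rampDeriv := by
  unfold rampDeriv
  refine Continuous.div (by fun_prop) (by fun_prop) fun s => by positivity

theorem ramp_nonneg (s : ℝ) : 0 ≤ ramp s := by unfold ramp; positivity

theorem ramp_le_one (s : ℝ) : ramp s ≤ 1 := by
  unfold ramp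
  rw [div_le_one (by positivity)]; linarith

theorem rampDeriv_nonneg (s : ℝ) : 0 ≤ rampDeriv s := by
  unfold rampDeriv
  have := le_max_right s 0
  positivity

theorem rampDeriv_le_two (s : ℝ) : rampDeriv s ≤ 2 := by
  unfold rampDeriv
  have := le_max_right s 0
  rw [div_le_iff₀ (by positivity)]
  nlinarith [sq_nonneg (max s 0 - 1), sq_nonneg (max s 0 ^ 2)]

theorem rampDeriv_pos {s : ℝ} (hs : 0 < s) : 0 < rampDeriv s := by
  unfold rampDeriv
  rw [max_eq_left hs.le]
  positivity

theorem ramp_of_nonpos {s : ℝ} (hs : s ≤ 0) : ramp s = 0 := by simp [ramp, max_eq_right hs]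

theorem rampDeriv_of_nonpos {s : ℝ} (hs : s ≤ 0) : rampDeriv s = 0 := by
  simp [rampDeriv, max_eq_right hs]

end Weight

/-! ### Weights supported in past light cones -/

section Cone

variable {E : Type*} [NormedAddCommGroup E]

/-- The smoothed spatial distance `√(ε² + ‖x - x₀‖²)`. -/
def smoothDist (ε : ℝ) (x₀ : E) (p : ℝ × E) : ℝ := √(ε ^ 2 + ‖p.2 - x₀‖ ^ 2)

theorem smoothDist_pos {ε : ℝ} (hε : 0 < ε) (x₀ : E) (p : ℝ × E) : 0 < smoothDist ε x₀ p :=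
  Real.sqrt_pos.2 (by positivity)

theorem norm_le_smoothDist (ε : ℝ) (x₀ : E) (p : ℝ × E) : ‖p.2 - x₀‖ ≤ smoothDist ε x₀ p :=
  Real.le_sqrt_of_sq_le (by nlinarith [sq_nonneg ε])

theorem continuous_smoothDist (ε : ℝ) (x₀ : E) : Continuous (smoothDist ε x₀) := by
  unfold smoothDist; fun_prop

variable [InnerProductSpace ℝ E]

theorem hasFDerivAt_smoothDist {ε : ℝ} (hε : 0 < ε) (x₀ : E) (p : ℝ × E) :
    HasFDerivAt (smoothDist ε x₀)
      ((1 / smoothDist ε x₀ p) • (innerSL ℝ (p.2 - x₀)).comp (ContinuousLinearMap.snd ℝ ℝ E)) p := by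
  have h1 : HasFDerivAt (fun p : ℝ × E => p.2 - x₀) (ContinuousLinearMap.snd ℝ ℝ E) p :=
    hasFDerivAt_snd.sub_const x₀
  have h2 := (h1.norm_sq.const_add (ε ^ 2)).sqrt (by positivity)
  refine h2.congr_fderiv ?_
  ext v
  · simp [smoothDist]
  · simp [smoothDist]; ring

/-- A `C¹` weight supported in the causal past of `(τ, x₀)`. -/
def coneWeight (ε τ : ℝ) (x₀ : E) (p : ℝ × E) : ℝ := ramp (τ - p.1 - smoothDist ε x₀ p)

theorem hasFDerivAt_coneWeight {ε : ℝ} (hε : 0 < ε) (τ : ℝ) (x₀ : E) (p : ℝ × E) :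
    HasFDerivAt (coneWeight ε τ x₀) (rampDeriv (τ - p.1 - smoothDist ε x₀ p) •
      (-(ContinuousLinearMap.fst ℝ ℝ E) - (1 / smoothDist ε x₀ p) •
        (innerSL ℝ (p.2 - x₀)).comp (ContinuousLinearMap.snd ℝ ℝ E))) p := by
  have h1 : HasFDerivAt (fun p : ℝ × E => τ - p.1) (-(ContinuousLinearMap.fst ℝ ℝ E)) p :=
    (hasFDerivAt_fst (p := p)).const_sub τ
  exact (hasDerivAt_ramp _).comp_hasFDerivAt p (h1.sub (hasFDerivAt_smoothDist hε x₀ p))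

theorem dirDeriv_coneWeight {ε : ℝ} (hε : 0 < ε) (τ : ℝ) (x₀ : E) (v p : ℝ × E) :
    dirDeriv v (coneWeight ε τ x₀) p = rampDeriv (τ - p.1 - smoothDist ε x₀ p) *
      (-v.1 - inner ℝ (p.2 - x₀) v.2 / smoothDist ε x₀ p) := by
  simp only [dirDeriv, (hasFDerivAt_coneWeight hε τ x₀ p).fderiv]
  simp [div_eq_inv_mul, inner_sub_left]

theorem differentiable_coneWeight {ε : ℝ} (hε : 0 < ε) (τ : ℝ) (x₀ : E) :
    Differentiable ℝ (coneWeight ε τ x₀) :=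
  fun p => (hasFDerivAt_coneWeight hε τ x₀ p).differentiableAt

theorem continuous_dirDeriv_coneWeight {ε : ℝ} (hε : 0 < ε) (τ : ℝ) (x₀ : E) (v : ℝ × E) :
    Continuous (dirDeriv v (coneWeight ε τ x₀)) := by
  rw [show dirDeriv v (coneWeight ε τ x₀) = _ from funext fun p => dirDeriv_coneWeight hε τ x₀ v p]
  have h := continuous_smoothDist ε x₀
  refine (continuous_rampDeriv.comp (by fun_prop)).mul (continuous_const.sub (Continuous.div ?_ h
    fun p => (smoothDist_pos hε x₀ p).ne'))
  fun_prop

omit [InnerProductSpace ℝ E] in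
theorem nonpos_of_notMem_causalPast (ε : ℝ) {τ : ℝ} {x₀ : E} {p : ℝ × E}
    (hp : p ∉ causalPast (τ, x₀)) : τ - p.1 - smoothDist ε x₀ p ≤ 0 := by
  have h1 : ¬ ‖x₀ - p.2‖ ≤ τ - p.1 := hp
  have h2 := norm_le_smoothDist ε x₀ p
  rw [norm_sub_rev] at h1
  linarith

omit [InnerProductSpace ℝ E] in
theorem norm_coneWeight_le (ε τ : ℝ) (x₀ : E) (p : ℝ × E) : ‖coneWeight ε τ x₀ p‖ ≤ 1 := by
  rw [coneWeight, Real.norm_of_nonneg (ramp_nonneg _)]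
  exact ramp_le_one _

theorem norm_dirDeriv_coneWeight_le {ε : ℝ} (hε : 0 < ε) (τ : ℝ) (x₀ : E) (v p : ℝ × E) :
    ‖dirDeriv v (coneWeight ε τ x₀) p‖ ≤ 2 * (|v.1| + ‖v.2‖) := by
  rw [dirDeriv_coneWeight hε, norm_mul, Real.norm_of_nonneg (rampDeriv_nonneg _)]
  refine mul_le_mul (rampDeriv_le_two _) ?_ (norm_nonneg _) zero_le_two
  refine (norm_sub_le _ _).trans (add_le_add (by simp) ?_)
  have hpos := smoothDist_pos hε x₀ p
  rw [norm_div, Real.norm_of_nonneg hpos.le, div_le_iff₀ hpos, mul_comm]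
  exact (norm_inner_le_norm _ _).trans
    (mul_le_mul_of_nonneg_right (norm_le_smoothDist ε x₀ p) (norm_nonneg _))

end Cone

/-! ### The energy estimate -/

section Energy

variable {E : Type*} [NormedAddCommGroup E] [InnerProductSpace ℝ E] [FiniteDimensional ℝ E]
  [MeasurableSpace E] [BorelSpace E]

instance : (volume : Measure (ℝ × E)).IsAddHaarMeasure :=
  inferInstanceAs ((volume : Measure ℝ).prod (volume : Measure E)).IsAddHaarMeasure

theorem integrable_mul_of_eq_zero_off {a g : ℝ × E → ℝ} {C : Set (ℝ × E)} {c : ℝ}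
    (ha : Continuous a) (hb : ∀ p, ‖a p‖ ≤ c) (hz : ∀ p ∉ C, a p = 0) (hg : IntegrableOn g C) :
    Integrable fun p => a p * g p := by
  have h1 : IntegrableOn (fun p => a p * g p) C :=
    Integrable.bdd_mul hg ha.aestronglyMeasurable (Eventually.of_forall hb)
  refine (integrableOn_iff_integrable_of_support_subset fun p hp => ?_).1 h1
  by_contra hC
  exact hp (by simp [hz p hC])

/-- The weight and its derivatives are bounded and vanish off the cone, so integrability of `g` on
the cone alone allows integration by parts over all of spacetime, without boundary terms. -/
theorem integral_coneWeight_mul_dirDeriv {ε : ℝ} (hε : 0 < ε) {τ : ℝ} {x₀ : E} {g : ℝ × E → ℝ}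
    (v : ℝ × E) (hg : Differentiable ℝ g) (hi : IntegrableOn g (causalPast (τ, x₀)))
    (hi' : IntegrableOn (dirDeriv v g) (causalPast (τ, x₀))) :
    Integrable (fun p => coneWeight ε τ x₀ p * dirDeriv v g p) ∧
    Integrable (fun p => dirDeriv v (coneWeight ε τ x₀) p * g p) ∧
    ∫ p, coneWeight ε τ x₀ p * dirDeriv v g p = -∫ p, dirDeriv v (coneWeight ε τ x₀) p * g p := by
  have hw := differentiable_coneWeight hε τ x₀
  have hz : ∀ p ∉ causalPast (τ, x₀), coneWeight ε τ x₀ p = 0 := fun p hp =>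
    ramp_of_nonpos (nonpos_of_notMem_causalPast ε hp)
  have hz' : ∀ p ∉ causalPast (τ, x₀), dirDeriv v (coneWeight ε τ x₀) p = 0 := fun p hp => by
    rw [dirDeriv_coneWeight hε, rampDeriv_of_nonpos (nonpos_of_notMem_causalPast ε hp), zero_mul]
  have i1 := integrable_mul_of_eq_zero_off hw.continuous (norm_coneWeight_le ε τ x₀) hz hi'
  have i2 := integrable_mul_of_eq_zero_off (continuous_dirDeriv_coneWeight hε τ x₀ v)
    (norm_dirDeriv_coneWeight_le hε τ x₀ v) hz' hi
  have i3 := integrable_mul_of_eq_zero_off hw.continuous (norm_coneWeight_le ε τ x₀) hz hi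
  exact ⟨i1, i2, integral_mul_fderiv_eq_neg_fderiv_mul_of_integrable i2 i1 i3
    (fun p _ => hw p) (fun p _ => hg p)⟩

/-- The energy estimate: a solution of the Klein-Gordon equation in a past light cone whose
derivatives up to second order are square integrable there vanishes below the tip. -/
theorem eq_zero_of_kleinGordon_real {ι : Type*} [Fintype ι] (b : OrthonormalBasis ι ℝ E) {M : ℝ}
    (hM : 0 < M) {u : ℝ × E → ℝ} (hu : ContDiff ℝ ∞ u) {q : ℝ × E} {δ : ℝ} (hδ : 0 < δ)
    (heq : ∀ p ∈ causalPast (q.1 + δ, q.2), -dirDeriv (1, 0) (dirDeriv (1, 0) u) p +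
      ∑ i, dirDeriv (0, b i) (dirDeriv (0, b i) u) p - M * u p = 0)
    (h0 : MemLp u 2 (volume.restrict (causalPast (q.1 + δ, q.2))))
    (h1 : ∀ v, MemLp (dirDeriv v u) 2 (volume.restrict (causalPast (q.1 + δ, q.2))))
    (h2 : ∀ v w, MemLp (dirDeriv v (dirDeriv w u)) 2
      (volume.restrict (causalPast (q.1 + δ, q.2)))) : u q = 0 := by
  set C := causalPast (q.1 + δ, q.2) with hC
  set t : ℝ × E := (1, 0) with ht
  set s : ι → ℝ × E := fun i => (0, b i) with hs
  -- At `q` the smoothed distance equals `ε`, so the argument of `ramp` there is `δ - ε = δ / 2 >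
  -- 0`.
  set ε := δ / 2 with hε'
  have hε : 0 < ε := by positivity
  obtain ⟨w, hw⟩ : ∃ w, w = coneWeight ε (q.1 + δ) q.2 := ⟨_, rfl⟩
  -- `e` is the energy density and `g i` the energy flux; the equation implies `∂ₜ e = ∑ ∂ᵢ gᵢ` on
  -- the cone.
  obtain ⟨e, he⟩ : ∃ e : ℝ × E → ℝ, e = fun p => 1 / 2 * (dirDeriv t u p * dirDeriv t u p +
    ∑ i, dirDeriv (s i) u p * dirDeriv (s i) u p + M * (u p * u p)) := ⟨_, rfl⟩
  obtain ⟨g, hg⟩ : ∃ g : ι → ℝ × E → ℝ, g = fun i p => dirDeriv t u p * dirDeriv (s i) u p :=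
    ⟨_, rfl⟩
  have du := hu.differentiable_infty
  have d1 : ∀ v, Differentiable ℝ (dirDeriv v u) := fun v => (hu.dirDeriv v).differentiable_infty
  have d2 : ∀ v w, Differentiable ℝ fun p => dirDeriv v u p * dirDeriv w u p :=
    fun v w => (d1 v).mul (d1 w)
  have dg : ∀ i, Differentiable ℝ (g i) := fun i => by rw [hg]; exact d2 t (s i)
  have de : Differentiable ℝ e := by
    rw [he]
    exact ((((d2 t t).add (Differentiable.fun_sum fun i _ =>
    d2 (s i) (s i))).add ((du.mul du).const_mul M)).const_mul _)
  have hDe : dirDeriv t e = fun p => dirDeriv t u p * dirDeriv t (dirDeriv t u) p +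
      ∑ i, dirDeriv (s i) u p * dirDeriv (s i) (dirDeriv t u) p + M * (u p * dirDeriv t u p) := by
    ext p
    have hS : Differentiable ℝ fun p => ∑ i, dirDeriv (s i) u p * dirDeriv (s i) u p :=
      Differentiable.fun_sum fun i _ => d2 (s i) (s i)
    have hA : Differentiable ℝ fun p => dirDeriv t u p * dirDeriv t u p +
        ∑ i, dirDeriv (s i) u p * dirDeriv (s i) u p := (d2 t t).add hS
    have hB : Differentiable ℝ fun p => M * (u p * u p) := (du.mul du).const_mul M
    have hUU : Differentiable ℝ fun p => u p * u p := du.mul du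
    have hAB : Differentiable ℝ fun p => dirDeriv t u p * dirDeriv t u p +
        ∑ i, dirDeriv (s i) u p * dirDeriv (s i) u p + M * (u p * u p) := hA.add hB
    simp only [he]
    rw [dirDeriv_mul (differentiable_const _) hAB, dirDeriv_add hA hB,
      dirDeriv_add (d2 t t) hS,
      dirDeriv_sum fun i _ => d2 (s i) (s i), dirDeriv_mul (d1 t) (d1 t),
      dirDeriv_mul (differentiable_const _) hUU, dirDeriv_mul du du]
    simp only [dirDeriv_mul (d1 (s _)) (d1 (s _)), dirDeriv_comm hu t (s _)]
    have hc : ∀ c : ℝ, dirDeriv t (fun _ : ℝ × E => c) p = 0 := fun c => by simp [dirDeriv]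
    rw [hc, hc]
    have : ∑ i, (dirDeriv (s i) u p * dirDeriv (s i) (dirDeriv t u) p +
        dirDeriv (s i) (dirDeriv t u) p * dirDeriv (s i) u p) =
        2 * ∑ i, dirDeriv (s i) u p * dirDeriv (s i) (dirDeriv t u) p := by
      rw [Finset.mul_sum]; exact Finset.sum_congr rfl fun i _ => by ring
    rw [this]; ring
  have hDg : ∀ i, dirDeriv (s i) (g i) = fun p => dirDeriv t u p *
      dirDeriv (s i) (dirDeriv (s i) u) p + dirDeriv (s i) (dirDeriv t u) p * dirDeriv (s i) u p :=
    fun i => by rw [hg]; exact dirDeriv_mul (d1 t) (d1 (s i)) (s i)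
  have mul_int : ∀ {f k : ℝ × E → ℝ}, MemLp f 2 (volume.restrict C) →
      MemLp k 2 (volume.restrict C) → IntegrableOn (fun p => f p * k p) C :=
    fun hf hk => MemLp.integrable_mul hf hk
  have ie : IntegrableOn e C := by
    rw [he]
    exact (((mul_int (h1 t) (h1 t)).add (integrable_finsetSum _ fun i _ =>
    mul_int (h1 (s i)) (h1 (s i)))).add ((mul_int h0 h0).const_mul M)).const_mul _
  have ie' : IntegrableOn (dirDeriv t e) C := by
    rw [hDe]
    exact ((mul_int (h1 t) (h2 t t)).add (integrable_finsetSum _ fun i _ =>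
      mul_int (h1 (s i)) (h2 (s i) t))).add ((mul_int h0 (h1 t)).const_mul M)
  have ig : ∀ i, IntegrableOn (g i) C := fun i => by rw [hg]; exact mul_int (h1 t) (h1 (s i))
  have ig' : ∀ i, IntegrableOn (dirDeriv (s i) (g i)) C := fun i => by
    rw [hDg]
    exact (mul_int (h1 t) (h2 (s i) (s i))).add (mul_int (h2 (s i) t) (h1 (s i)))
  obtain ⟨A1, A2, A3⟩ := integral_coneWeight_mul_dirDeriv hε t de ie ie'
  have B := fun i => integral_coneWeight_mul_dirDeriv hε (s i) (dg i) (ig i) (ig' i)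
  rw [← hw] at A1 A2 A3 B
  -- `Q` is what remains of the weighted conservation law once all derivatives have been moved onto
  -- the weight. Its integral is zero, and it will turn out to be nonnegative.
  obtain ⟨Q, hQ⟩ : ∃ Q : ℝ × E → ℝ,
      Q = fun p => -(dirDeriv t w p * e p) + ∑ i, dirDeriv (s i) w p * g i p := ⟨_, rfl⟩
  have iS := integrable_finsetSum Finset.univ fun i (_ : i ∈ Finset.univ) => (B i).2.1
  have iQ : Integrable Q := by rw [hQ]; exact A2.fun_neg.add (integrable_finsetSum _ fun i _ => (B i).2.1)
  have hQ0 : ∫ p, Q p = 0 := by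
    have e1 : ∫ p, Q p = (∫ p, w p * dirDeriv t e p) - ∑ i, ∫ p, w p * dirDeriv (s i) (g i) p := by
      simp only [hQ]
      rw [integral_add A2.fun_neg iS, integral_neg,
        integral_finsetSum _ fun i _ => (B i).2.1, A3, Finset.sum_congr rfl fun i _ => (B i).2.2,
        Finset.sum_neg_distrib]
      ring
    rw [e1, ← integral_finsetSum _ fun i _ => (B i).1,
      ← integral_sub A1 (integrable_finsetSum _ fun i _ => (B i).1)]
    rw [← integral_zero (ℝ × E) ℝ (μ := volume)]
    congr 1
    ext p
    by_cases hp : p ∈ C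
    · rw [← Finset.mul_sum, hDe]
      simp only [hDg, Finset.sum_add_distrib, ← Finset.mul_sum]
      have h3 := heq p hp
      have h4 : ∑ i, dirDeriv (s i) (dirDeriv t u) p * dirDeriv (s i) u p =
          ∑ i, dirDeriv (s i) u p * dirDeriv (s i) (dirDeriv t u) p :=
        Finset.sum_congr rfl fun i _ => mul_comm _ _
      rw [h4]
      linear_combination (-(w p * dirDeriv t u p)) * h3
    · have : w p = 0 := hw ▸ ramp_of_nonpos (nonpos_of_notMem_causalPast ε hp)
      simp [this]
  -- The weight has time derivative `-k` and spatial gradient `-k (x - x₀) / r` with `‖x - x₀‖ ≤ r`.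
  -- Hence the flux term is at most `k |∂ₜu| |∇u|`, which the kinetic and gradient parts of `e`
  -- absorb, leaving the mass term.
  have hlow : ∀ p, rampDeriv (q.1 + δ - p.1 - smoothDist ε q.2 p) * (M / 2 * u p ^ 2) ≤ Q p := by
    intro p
    set k := rampDeriv (q.1 + δ - p.1 - smoothDist ε q.2 p) with hk
    have hk0 : 0 ≤ k := rampDeriv_nonneg _
    have hr := smoothDist_pos hε q.2 p
    set r := smoothDist ε q.2 p
    set Y := ∑ i, inner ℝ (p.2 - q.2) (b i) * dirDeriv (s i) u p with hY
    have hD : ∀ v, dirDeriv v w p = k * (-v.1 - inner ℝ (p.2 - q.2) v.2 / r) := fun v => by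
      rw [hw]; exact dirDeriv_coneWeight hε _ _ v p
    have hsum : ∑ i, k * (-(s i).1 - inner ℝ (p.2 - q.2) (s i).2 / r) *
        (dirDeriv t u p * dirDeriv (s i) u p) = -(k * (dirDeriv t u p * (Y / r))) := by
      rw [hY, Finset.sum_div, Finset.mul_sum, Finset.mul_sum, ← Finset.sum_neg_distrib]
      exact Finset.sum_congr rfl fun i _ => by simp only [hs]; ring
    have e2 : Q p = k * (e p - dirDeriv t u p * (Y / r)) := by
      simp only [hQ, hD, hg, hsum]
      simp only [ht, inner_zero_right]
      ring
    have hYr : (Y / r) ^ 2 ≤ ∑ i, dirDeriv (s i) u p * dirDeriv (s i) u p := by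
      rw [div_pow, div_le_iff₀ (by positivity)]
      have c1 := Finset.sum_mul_sq_le_sq_mul_sq Finset.univ
        (fun i => inner ℝ (p.2 - q.2) (b i)) (fun i => dirDeriv (s i) u p)
      rw [b.sum_sq_inner_left] at c1
      have c2 : ‖p.2 - q.2‖ ^ 2 ≤ r ^ 2 :=
        pow_le_pow_left₀ (norm_nonneg _) (norm_le_smoothDist ε q.2 p) 2
      have c3 : 0 ≤ ∑ i, dirDeriv (s i) u p ^ 2 := Finset.sum_nonneg fun i _ => sq_nonneg _
      simp only [← pow_two]
      calc Y ^ 2 ≤ _ := c1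
        _ ≤ r ^ 2 * ∑ i, dirDeriv (s i) u p ^ 2 := mul_le_mul_of_nonneg_right c2 c3
        _ = _ := mul_comm _ _
    rw [e2]
    refine mul_le_mul_of_nonneg_left ?_ hk0
    simp only [he]
    nlinarith [sq_nonneg (dirDeriv t u p - Y / r)]
  have hQnn : ∀ p, 0 ≤ Q p := fun p => le_trans (mul_nonneg (rampDeriv_nonneg _) (by positivity))
    (hlow p)
  have hQc : Continuous Q := by
    have hwc := fun v => continuous_dirDeriv_coneWeight hε (q.1 + δ) q.2 v
    rw [← hw] at hwc
    rw [hQ]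
    exact ((hwc t).mul de.continuous).neg.add (continuous_finsetSum _ fun i _ =>
      (hwc (s i)).mul (dg i).continuous)
  have hQz : Q = fun _ => 0 := by
    have := (integral_eq_zero_iff_of_nonneg hQnn iQ).1 hQ0
    exact (hQc.ae_eq_iff_eq volume continuous_const).1 this
  have hfin := hlow q
  rw [hQz] at hfin
  have hsq : smoothDist ε q.2 q = ε := by simp [smoothDist, Real.sqrt_sq hε.le]
  have hpos : 0 < rampDeriv (q.1 + δ - q.1 - smoothDist ε q.2 q) :=
    rampDeriv_pos (by rw [hsq, hε']; linarith)
  have h5 : M / 2 * u q ^ 2 ≤ 0 := by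
    by_contra h
    exact absurd hfin (not_le.2 (mul_pos hpos (not_le.1 h)))
  have h6 : u q ^ 2 ≤ 0 := by
    by_contra h
    exact absurd h5 (not_le.2 (mul_pos (by positivity) (not_le.1 h)))
  exact pow_eq_zero_iff two_ne_zero |>.1 (le_antisymm h6 (sq_nonneg _))

/-- The coefficients are real, so the real estimate applies to `L ∘ u` for every real-linear
functional `L` on `ℂ`. -/
theorem eq_zero_of_kleinGordon {M : ℝ} (hM : 0 < M) {u : ℝ × E → ℂ} (hu : ContDiff ℝ ∞ u)
    {q : ℝ × E} {δ : ℝ} (hδ : 0 < δ)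
    (heq : ∀ p ∈ causalPast (q.1 + δ, q.2), dAlembertian u p - M * u p = 0)
    (h0 : MemLp u 2 (volume.restrict (causalPast (q.1 + δ, q.2))))
    (h1 : ∀ v, MemLp (dirDeriv v u) 2 (volume.restrict (causalPast (q.1 + δ, q.2))))
    (h2 : ∀ v w, MemLp (dirDeriv v (dirDeriv w u)) 2
      (volume.restrict (causalPast (q.1 + δ, q.2)))) : u q = 0 := by
  have key : ∀ L : ℂ →L[ℝ] ℝ, L (u q) = 0 := by
    intro L
    have hL : ContDiff ℝ ∞ fun p => L (u p) := L.contDiff.comp hu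
    have e1 : ∀ v, dirDeriv v (fun p => L (u p)) = fun p => L (dirDeriv v u p) := fun v =>
      dirDeriv_clm_comp L hu.differentiable_infty v
    have e2 : ∀ v w, dirDeriv v (dirDeriv w fun p => L (u p)) =
        fun p => L (dirDeriv v (dirDeriv w u) p) := fun v w => by
      rw [e1, dirDeriv_clm_comp L (hu.dirDeriv w).differentiable_infty v]
    refine eq_zero_of_kleinGordon_real (stdOrthonormalBasis ℝ E) hM hL hδ (fun p hp => ?_)
      (L.comp_memLp' h0) (fun v => ?_) (fun v w => ?_)
    · have := congrArg L (heq p hp)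
      rw [dAlembertian_eq (stdOrthonormalBasis ℝ E) hu] at this
      simp only [e2]
      rw [show (M : ℂ) * u p = M • u p from (Complex.real_smul).symm] at this
      simpa only [map_sub, map_add, map_neg, map_sum, map_smul, smul_eq_mul, map_zero] using this
    · rw [e1]; exact L.comp_memLp' (h1 v)
    · rw [e2]; exact L.comp_memLp' (h2 v w)
  exact Complex.ext (by simpa using key Complex.reCLM) (by simpa using key Complex.imCLM)

end Energy

/-! ### Finite speed of propagation -/

section LocalUniqueness

variable {E : Type*} [NormedAddCommGroup E] [InnerProductSpace ℝ E] [FiniteDimensional ℝ E]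

/-- Finite speed of propagation for past-compact functions. -/
theorem IsPastCompactSmooth.eq_zero_of_kleinGordon {M : ℝ} (hM : 0 < M) {u : ℝ × E → ℂ}
    (hu : IsPastCompactSmooth u) {q : ℝ × E} {δ : ℝ} (hδ : 0 < δ)
    (heq : ∀ p ∈ causalPast (q.1 + δ, q.2), _root_.dAlembertian u p - M * u p = 0) : u q = 0 := by
  borelize E
  have hmem : ∀ {w : ℝ × E → ℂ}, IsPastCompactSmooth w →
      MemLp w 2 (volume.restrict (causalPast (q.1 + δ, q.2))) := by
    intro w hw
    obtain ⟨T, hT⟩ := (isPastCompactSmooth_iff.1 hw).2 (q.1 + δ, q.2)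
    -- On the cone `w` is supported in this compact piece, where it is bounded; this gives the
    -- square integrability needed by the energy estimate.
    set K := causalPast (q.1 + δ, q.2) ∩ {p : ℝ × E | T ≤ p.1}
    have hK : IsCompact K := isCompact_causalPast_inter _ T
    have hCm : MeasurableSet (causalPast (q.1 + δ, q.2)) := (isClosed_causalPast _).measurableSet
    have : IsFiniteMeasure (volume.restrict K) := isFiniteMeasure_restrict.2 hK.measure_ne_top
    obtain ⟨c, hc⟩ := hK.exists_bound_of_continuousOn hw.1.continuous.continuousOn
    have h1 : MemLp w 2 (volume.restrict K) := MemLp.of_bound hw.1.continuous.aestronglyMeasurable c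
      ((ae_restrict_iff' hK.measurableSet).2 (Eventually.of_forall hc))
    rw [← memLp_indicator_iff_restrict hK.measurableSet] at h1
    rw [← memLp_indicator_iff_restrict hCm]
    convert h1 using 1
    ext p
    by_cases hp : p ∈ causalPast (q.1 + δ, q.2)
    · by_cases hp' : T ≤ p.1
      · rw [indicator_of_mem hp, indicator_of_mem (show p ∈ K from ⟨hp, hp'⟩)]
      · rw [indicator_of_mem hp, indicator_of_notMem (fun h : p ∈ K => hp' h.2),
          hT p hp (not_le.1 hp')]
    · rw [indicator_of_notMem hp, indicator_of_notMem (fun h : p ∈ K => hp h.1)]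
  exact _root_.eq_zero_of_kleinGordon hM hu.1 hδ heq (hmem hu) (fun v => hmem (hu.dirDeriv v))
    (fun v w => hmem ((hu.dirDeriv w).dirDeriv v))

end LocalUniqueness

/-! ### The symbol of the damped Klein-Gordon operator -/

section Symbol

open SchwartzMap LineDeriv

variable {E : Type*} [NormedAddCommGroup E] [InnerProductSpace ℝ E]

/-- The Fourier symbol of `-(∂ₜ + 1)² + Δ - M`. -/
def dampedSymbol (M : ℝ) (ζ : WithLp 2 (ℝ × E)) : ℂ :=
  -(1 + 2 * Real.pi * Complex.I * (ζ.fst : ℂ)) ^ 2 - (2 * Real.pi) ^ 2 * (‖ζ.snd‖ : ℂ) ^ 2 - M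

/-- An auxiliary map of polynomial growth, a rescaling of `|dampedSymbol|² - (1 + 2 M)`. -/
def dampedSymbolAux (M : ℝ) (ζ : WithLp 2 (ℝ × E)) : WithLp 2 (ℝ × WithLp 2 (ℝ × E)) :=
  (√(1 + 2 * M))⁻¹ • ((WithLp.prodContinuousLinearEquiv 2 ℝ ℝ (WithLp 2 (ℝ × E))).symm
    ((2 * Real.pi) ^ 2 * ‖ζ.snd‖ ^ 2 + M - (2 * Real.pi) ^ 2 * ζ.fst ^ 2,
      (√2 * (2 * Real.pi)) • ζ))

/-- With `a = 2π ζ.fst` and `c = (2π)² ‖ζ.snd‖² + M` one has `(1 + c - a²)² + 4a² = 1 + 2c + 2a² +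
(c - a²)²`, a constant `1 + 2M` plus a sum of squares. So the symbol stays away from zero. -/
theorem normSq_dampedSymbol {M : ℝ} (hM : 0 < M) (ζ : WithLp 2 (ℝ × E)) :
    Complex.normSq (dampedSymbol M ζ) = (1 + 2 * M) * (1 + ‖dampedSymbolAux M ζ‖ ^ 2) := by
  have h1 : dampedSymbol M ζ = ((-(1 - (2 * Real.pi) ^ 2 * ζ.fst ^ 2 +
      ((2 * Real.pi) ^ 2 * ‖ζ.snd‖ ^ 2 + M)) : ℝ) : ℂ) +
      ((-2 * (2 * Real.pi * ζ.fst) : ℝ) : ℂ) * Complex.I := by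
    simp only [dampedSymbol]
    push_cast
    linear_combination (-(2 * Real.pi * (ζ.fst : ℂ)) ^ 2) * Complex.I_sq
  have hpos : (0 : ℝ) < 1 + 2 * M := by positivity
  have h2 : ‖dampedSymbolAux M ζ‖ ^ 2 = (1 + 2 * M)⁻¹ *
      (((2 * Real.pi) ^ 2 * ‖ζ.snd‖ ^ 2 + M - (2 * Real.pi) ^ 2 * ζ.fst ^ 2) ^ 2 +
        2 * (2 * Real.pi) ^ 2 * (ζ.fst ^ 2 + ‖ζ.snd‖ ^ 2)) := by
    rw [dampedSymbolAux, norm_smul, mul_pow ‖(√(1 + 2 * M))⁻¹‖, WithLp.prod_norm_sq_eq_of_L2]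
    simp only [WithLp.prodContinuousLinearEquiv_symm_apply, WithLp.toLp_fst, WithLp.toLp_snd]
    rw [norm_smul, mul_pow ‖√2 * (2 * Real.pi)‖, WithLp.prod_norm_sq_eq_of_L2 ζ]
    simp only [Real.norm_eq_abs, sq_abs, inv_pow, Real.sq_sqrt hpos.le]
    rw [mul_pow √2, Real.sq_sqrt zero_le_two]
  rw [h1, Complex.normSq_add_mul_I, h2, mul_add (1 + 2 * M), mul_inv_cancel_left₀ hpos.ne']
  ring

theorem one_le_norm_dampedSymbol {M : ℝ} (hM : 0 < M) (ζ : WithLp 2 (ℝ × E)) :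
    1 ≤ ‖dampedSymbol M ζ‖ := by
  have h := normSq_dampedSymbol hM ζ
  rw [Complex.normSq_eq_norm_sq] at h
  have : 1 ≤ ‖dampedSymbol M ζ‖ ^ 2 := by
    rw [h]; nlinarith [sq_nonneg ‖dampedSymbolAux M ζ‖]
  exact (one_le_sq_iff₀ (norm_nonneg _)).1 this

theorem dampedSymbol_ne_zero {M : ℝ} (hM : 0 < M) (ζ : WithLp 2 (ℝ × E)) :
    dampedSymbol M ζ ≠ 0 :=
  norm_pos_iff.1 (one_pos.trans_le (one_le_norm_dampedSymbol hM ζ))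

/-- The inverse is the conjugate divided by the squared modulus. By the preceding identity the
latter is a multiple of `1 + ‖·‖²` composed with a map of temperate growth, so its inverse is a
Bessel-type power composed with that map. -/
theorem hasTemperateGrowth_dampedSymbol_inv {M : ℝ} (hM : 0 < M) :
    (fun ζ : WithLp 2 (ℝ × E) => (dampedSymbol M ζ)⁻¹).HasTemperateGrowth := by
  have hfst : (fun ζ : WithLp 2 (ℝ × E) => ζ.fst).HasTemperateGrowth :=
    (WithLp.fstL 2 ℝ ℝ E).hasTemperateGrowth
  have hsnd : (fun ζ : WithLp 2 (ℝ × E) => ‖ζ.snd‖ ^ 2).HasTemperateGrowth :=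
    (Function.hasTemperateGrowth_norm_sq E).comp (WithLp.sndL 2 ℝ ℝ E).hasTemperateGrowth
  have haux : (dampedSymbolAux (E := E) M).HasTemperateGrowth := by
    have ha : (fun ζ : WithLp 2 (ℝ × E) =>
        (2 * Real.pi) ^ 2 * ‖ζ.snd‖ ^ 2 + M - (2 * Real.pi) ^ 2 * ζ.fst ^ 2).HasTemperateGrowth := by
      have h2 : (fun ζ : WithLp 2 (ℝ × E) => ζ.fst ^ 2).HasTemperateGrowth := hfst.pow 2
      fun_prop
    let e := (WithLp.prodContinuousLinearEquiv 2 ℝ ℝ (WithLp 2 (ℝ × E))).symm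
    let L1 := e.toContinuousLinearMap.comp (ContinuousLinearMap.inl ℝ ℝ (WithLp 2 (ℝ × E)))
    let L2 := e.toContinuousLinearMap.comp (ContinuousLinearMap.inr ℝ ℝ (WithLp 2 (ℝ × E)))
    have h1 : dampedSymbolAux (E := E) M = fun ζ => (√(1 + 2 * M))⁻¹ • (L1
        ((2 * Real.pi) ^ 2 * ‖ζ.snd‖ ^ 2 + M - (2 * Real.pi) ^ 2 * ζ.fst ^ 2) +
        L2 ((√2 * (2 * Real.pi)) • ζ)) := by
      ext1 ζ
      simp only [dampedSymbolAux, L1, L2, ContinuousLinearMap.comp_apply]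
      congr 1
      change _ = e _ + e _
      rw [← map_add]
      simp [e]
    rw [h1]
    have h3 := L1.hasTemperateGrowth.comp ha
    have h4 : (fun ζ : WithLp 2 (ℝ × E) => L2 ((√2 * (2 * Real.pi)) • ζ)).HasTemperateGrowth :=
      L2.hasTemperateGrowth.comp (by fun_prop)
    exact (Function.HasTemperateGrowth.const ((√(1 + 2 * M))⁻¹)).smul (h3.add h4)
  have hbess := (Function.hasTemperateGrowth_one_add_norm_sq_rpow
    (WithLp 2 (ℝ × WithLp 2 (ℝ × E))) (-1)).comp haux
  have hre : (fun ζ : WithLp 2 (ℝ × E) => (((-(1 - (2 * Real.pi) ^ 2 * ζ.fst ^ 2 +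
      ((2 * Real.pi) ^ 2 * ‖ζ.snd‖ ^ 2 + M))) * ((1 + 2 * M)⁻¹ *
      (1 + ‖dampedSymbolAux M ζ‖ ^ 2) ^ (-1 : ℝ)) : ℝ) : ℂ)).HasTemperateGrowth := by
    refine Complex.ofRealCLM.hasTemperateGrowth.comp (Function.HasTemperateGrowth.mul ?_
      ((Function.HasTemperateGrowth.const _).mul hbess))
    have h2 : (fun ζ : WithLp 2 (ℝ × E) => ζ.fst ^ 2).HasTemperateGrowth := hfst.pow 2
    fun_prop
  have him : (fun ζ : WithLp 2 (ℝ × E) => ((2 * (2 * Real.pi * ζ.fst) * ((1 + 2 * M)⁻¹ *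
      (1 + ‖dampedSymbolAux M ζ‖ ^ 2) ^ (-1 : ℝ)) : ℝ) : ℂ)).HasTemperateGrowth := by
    refine Complex.ofRealCLM.hasTemperateGrowth.comp (Function.HasTemperateGrowth.mul ?_
      ((Function.HasTemperateGrowth.const _).mul hbess))
    fun_prop
  have hfin := hre.add (him.mul (Function.HasTemperateGrowth.const Complex.I))
  convert hfin using 1
  ext ζ
  have hn := normSq_dampedSymbol hM ζ
  rw [Complex.inv_def, hn, mul_inv, ← Real.rpow_neg_one (1 + ‖dampedSymbolAux M ζ‖ ^ 2)]
  have hconj : (starRingEnd ℂ) (dampedSymbol M ζ) = ((-(1 - (2 * Real.pi) ^ 2 * ζ.fst ^ 2 +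
      ((2 * Real.pi) ^ 2 * ‖ζ.snd‖ ^ 2 + M)) : ℝ) : ℂ) +
      ((2 * (2 * Real.pi * ζ.fst) : ℝ) : ℂ) * Complex.I := by
    simp only [dampedSymbol]
    simp only [map_sub, map_neg, map_pow, map_add, map_one, map_mul, Complex.conj_ofReal,
      Complex.conj_I, map_ofNat]
    push_cast
    linear_combination (-(2 * Real.pi * (ζ.fst : ℂ)) ^ 2) * Complex.I_sq
  rw [hconj]
  simp only [Pi.add_apply, Pi.mul_apply]
  push_cast
  ring

end Symbol

/-! ### Solutions by Fourier transform after exponential damping -/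

section Damped

open SchwartzMap LineDeriv

variable {E : Type*} [NormedAddCommGroup E] [InnerProductSpace ℝ E]

/-- The function `(t, x) ↦ eᵗ S(t, x)` for a Schwartz function `S` on spacetime. -/
def expMulSchwartz (S : 𝓢(WithLp 2 (ℝ × E), ℂ)) (p : ℝ × E) : ℂ :=
  (Real.exp p.1 : ℂ) * S (WithLp.toLp 2 p)

theorem contDiff_expMulSchwartz (S : 𝓢(WithLp 2 (ℝ × E), ℂ)) :
    ContDiff ℝ ∞ (expMulSchwartz S) := by
  have h1 : ContDiff ℝ ∞ fun p : ℝ × E => (Real.exp p.1 : ℂ) :=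
    Complex.ofRealCLM.contDiff.comp (Real.contDiff_exp.comp contDiff_fst)
  exact h1.mul ((S.smooth ⊤).comp (WithLp.prodContinuousLinearEquiv 2 ℝ ℝ E).symm.contDiff)

theorem dirDeriv_expMulSchwartz (S : 𝓢(WithLp 2 (ℝ × E), ℂ)) (v : ℝ × E) :
    dirDeriv v (expMulSchwartz S) =
      expMulSchwartz ((v.1 : ℂ) • S + ∂_{(WithLp.toLp 2 v : WithLp 2 (ℝ × E))} S) := by
  have h1 : ContDiff ℝ ∞ fun p : ℝ × E => (Real.exp p.1 : ℂ) :=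
    Complex.ofRealCLM.contDiff.comp (Real.contDiff_exp.comp contDiff_fst)
  let e := (WithLp.prodContinuousLinearEquiv 2 ℝ ℝ E).symm.toContinuousLinearMap
  have h2 := dirDeriv_comp_clm e (S.smooth ⊤).differentiable_infty v
  have h2' : Differentiable ℝ fun p : ℝ × E => S (e p) :=
    ((S.smooth ⊤).comp e.contDiff).differentiable_infty
  have h3 : dirDeriv v (fun p : ℝ × E => (Real.exp p.1 : ℂ)) =
      fun p => (v.1 : ℂ) * (Real.exp p.1 : ℂ) := by
    ext p
    have hd : HasFDerivAt (fun p : ℝ × E => Real.exp p.1)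
        (Real.exp p.1 • ContinuousLinearMap.fst ℝ ℝ E) p :=
      (Real.hasDerivAt_exp p.1).comp_hasFDerivAt p hasFDerivAt_fst
    have := (Complex.ofRealCLM.hasFDerivAt.comp p hd).fderiv
    simp only [dirDeriv]
    change fderiv ℝ (Complex.ofRealCLM ∘ fun p : ℝ × E => Real.exp p.1) p v = _
    rw [this]
    simp [mul_comm]
  have h4 := dirDeriv_mul h1.differentiable_infty h2' v
  ext p
  change dirDeriv v (fun p : ℝ × E => (Real.exp p.1 : ℂ) * S (e p)) p = _
  rw [h4, h2, h3]
  simp only [expMulSchwartz, add_apply, smul_apply, lineDerivOp_apply_eq_fderiv, smul_eq_mul]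
  change _ * fderiv ℝ S (WithLp.toLp 2 p) (WithLp.toLp 2 v) + _ * S (WithLp.toLp 2 p) = _
  ring

variable [FiniteDimensional ℝ E]

/-- Time is bounded above on a causal past, hence so is `eᵗ`. This lets the energy estimate act on
cones unbounded towards the past, before any vanishing is known. -/
theorem memLp_expMulSchwartz [MeasurableSpace E] [BorelSpace E] (S : 𝓢(WithLp 2 (ℝ × E), ℂ))
    (p₀ : ℝ × E) : MemLp (expMulSchwartz S) 2 (volume.restrict (causalPast p₀)) := by
  have h1 : MemLp (fun p : ℝ × E => S (WithLp.toLp 2 p)) 2 (volume : Measure (ℝ × E)) :=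
    (compCLMOfContinuousLinearEquiv ℝ
      (WithLp.prodContinuousLinearEquiv 2 ℝ ℝ E).symm S).memLp 2 volume
  refine (h1.restrict _).of_le_mul (c := Real.exp p₀.1)
    (contDiff_expMulSchwartz S).continuous.aestronglyMeasurable ?_
  refine (ae_restrict_iff' (isClosed_causalPast p₀).measurableSet).2 (Eventually.of_forall ?_)
  intro p hp
  rw [expMulSchwartz, norm_mul, Complex.norm_real, Real.norm_of_nonneg (Real.exp_nonneg _)]
  exact mul_le_mul_of_nonneg_right (Real.exp_le_exp.2 (causalPast_time_le hp)) (norm_nonneg _)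

variable [MeasurableSpace E] [BorelSpace E]

/-- The Fourier transform of the solution of `(-(∂ₜ + 1)² + Δ - M) u = G`. -/
def dampedFourier (M : ℝ) (G : 𝓢(WithLp 2 (ℝ × E), ℂ)) : 𝓢(WithLp 2 (ℝ × E), ℂ) :=
  smulLeftCLM ℂ (fun ζ => (dampedSymbol M ζ)⁻¹) (𝓕 G)

theorem dampedFourier_apply {M : ℝ} (hM : 0 < M) (G : 𝓢(WithLp 2 (ℝ × E), ℂ))
    (ζ : WithLp 2 (ℝ × E)) : dampedFourier M G ζ = (dampedSymbol M ζ)⁻¹ * 𝓕 G ζ := by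
  rw [dampedFourier, smulLeftCLM_apply_apply (hasTemperateGrowth_dampedSymbol_inv hM), smul_eq_mul]

theorem kleinGordon_expMulSchwartz {M : ℝ} (hM : 0 < M) (G : 𝓢(WithLp 2 (ℝ × E), ℂ))
    (p : ℝ × E) : dAlembertian (expMulSchwartz (𝓕⁻ (dampedFourier M G))) p -
      M * expMulSchwartz (𝓕⁻ (dampedFourier M G)) p = expMulSchwartz G p := by
  set b := stdOrthonormalBasis ℝ E
  set U := dampedFourier M G with hU
  let A : WithLp 2 (ℝ × E) → 𝓢(WithLp 2 (ℝ × E), ℂ) → 𝓢(WithLp 2 (ℝ × E), ℂ) := fun v f =>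
    (2 * Real.pi * Complex.I) • smulLeftCLM ℂ (inner ℝ · v) f
  have hA : ∀ v f ζ, A v f ζ = 2 * Real.pi * Complex.I * (inner ℝ ζ v : ℂ) * f ζ := by
    intro v f ζ
    have : (inner ℝ · v : WithLp 2 (ℝ × E) → ℝ).HasTemperateGrowth := by fun_prop
    simp only [A, smul_apply, smulLeftCLM_apply_apply this, smul_eq_mul, Complex.real_smul]
    ring
  have hI : ∀ v f, ∂_{v} (𝓕⁻ f : 𝓢(WithLp 2 (ℝ × E), ℂ)) = 𝓕⁻ (A v f) := fun v f =>
    lineDerivOp_fourierInv_eq f v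
  let τ : WithLp 2 (ℝ × E) := WithLp.toLp 2 (1, 0)
  let e : Fin (Module.finrank ℝ E) → WithLp 2 (ℝ × E) := fun i => WithLp.toLp 2 (0, b i)
  have h1 : ∀ f : 𝓢(WithLp 2 (ℝ × E), ℂ), dirDeriv (1, 0) (expMulSchwartz (𝓕⁻ f)) =
      expMulSchwartz (𝓕⁻ (f + A τ f)) := by
    intro f
    rw [dirDeriv_expMulSchwartz, hI, FourierTransform.fourierInv_add]
    simp [τ]
  have h2 : ∀ i, ∀ f : 𝓢(WithLp 2 (ℝ × E), ℂ), dirDeriv (0, b i) (expMulSchwartz (𝓕⁻ f)) =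
      expMulSchwartz (𝓕⁻ (A (e i) f)) := by
    intro i f
    rw [dirDeriv_expMulSchwartz, hI]
    simp [e]
  rw [dAlembertian_eq b (contDiff_expMulSchwartz _)]
  simp only [h1, h2]
  -- On the Fourier side `∂ᵥ` becomes `A v`, and the factor `eᵗ` turns `∂ₜ` into `1 + A τ`; the
  -- operator is then multiplication by `dampedSymbol`, which cancels its inverse in `U`.
  have key : -(U + A τ U + A τ (U + A τ U)) + ∑ i, A (e i) (A (e i) U) - (M : ℂ) • U = 𝓕 G := by
    ext ζ
    have hs : ∑ i, (inner ℝ ζ (e i) : ℂ) ^ 2 = (‖ζ.snd‖ : ℂ) ^ 2 := by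
      have := b.sum_sq_inner_left ζ.snd
      have h3 : ∀ i, inner ℝ ζ (e i) = inner ℝ ζ.snd (b i) := fun i => by
        simp [e, WithLp.prod_inner_apply]
      simp only [h3]
      exact_mod_cast this
    have ht : (inner ℝ ζ τ : ℂ) = (ζ.fst : ℂ) := by
      simp [τ, WithLp.prod_inner_apply]
    simp only [sub_apply, add_apply, neg_apply, smul_apply, sum_apply, hA, ht, smul_eq_mul]
    have hs2 : ∑ i, 2 * Real.pi * Complex.I * (inner ℝ ζ (e i) : ℂ) *
        (2 * Real.pi * Complex.I * (inner ℝ ζ (e i) : ℂ) * U ζ) =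
        -(2 * Real.pi) ^ 2 * (‖ζ.snd‖ : ℂ) ^ 2 * U ζ := by
      rw [← hs, Finset.mul_sum, Finset.sum_mul]
      refine Finset.sum_congr rfl fun i _ => ?_
      linear_combination ((2 * Real.pi) ^ 2 * (inner ℝ ζ (e i) : ℂ) ^ 2 * U ζ) * Complex.I_sq
    rw [hs2]
    have h4 : dampedSymbol M ζ * U ζ = 𝓕 G ζ := by
      rw [hU, dampedFourier_apply hM, mul_inv_cancel_left₀ (dampedSymbol_ne_zero hM ζ)]
    rw [← h4, dampedSymbol]
    ring
  have h5 := congrArg (fun f : 𝓢(WithLp 2 (ℝ × E), ℂ) => expMulSchwartz (𝓕⁻ f) p) key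
  simp only [FourierTransform.fourierInv_fourier_eq] at h5
  have hlin : ∀ f : 𝓢(WithLp 2 (ℝ × E), ℂ),
      (𝓕⁻ f : 𝓢(WithLp 2 (ℝ × E), ℂ)) = FourierTransform.fourierInvCLM ℂ 𝓢(WithLp 2 (ℝ × E), ℂ) f :=
    fun f => rfl
  rw [← h5]
  simp only [hlin, map_sub, map_add, map_neg, map_sum, map_smul]
  simp only [expMulSchwartz, sub_apply, add_apply, neg_apply,
    smul_apply, sum_apply, smul_eq_mul, mul_sub, mul_add, Finset.mul_sum, mul_neg]
  ring

/-- Since the symbol has modulus at least `1` for every positive mass, the bound does not involve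
`M`. -/
theorem norm_expMulSchwartz_le {M : ℝ} (hM : 0 < M) (G : 𝓢(WithLp 2 (ℝ × E), ℂ)) (p : ℝ × E) :
    ‖expMulSchwartz (𝓕⁻ (dampedFourier M G)) p‖ ≤ Real.exp p.1 * ∫ ζ, ‖𝓕 G ζ‖ := by
  rw [expMulSchwartz, norm_mul, Complex.norm_real, Real.norm_of_nonneg (Real.exp_nonneg _)]
  refine mul_le_mul_of_nonneg_left ?_ (Real.exp_nonneg _)
  rw [fourierInv_coe, Real.fourierInv_eq]
  refine (norm_integral_le_integral_norm _).trans (integral_mono_of_nonneg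
    (Eventually.of_forall fun ζ => norm_nonneg _) (𝓕 G).integrable.norm
    (Eventually.of_forall fun ζ => ?_))
  simp only [Circle.norm_smul]
  rw [dampedFourier_apply hM, norm_mul, norm_inv]
  exact mul_le_of_le_one_left (norm_nonneg _) (inv_le_one_of_one_le₀ (one_le_norm_dampedSymbol hM ζ))

theorem continuousOn_expMulSchwartz (G : 𝓢(WithLp 2 (ℝ × E), ℂ)) (p : ℝ × E) :
    ContinuousOn (fun M : ℝ => expMulSchwartz (𝓕⁻ (dampedFourier M G)) p) (Ioi 0) := by
  refine continuousOn_const.mul ?_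
  have h1 : EqOn (fun M : ℝ => (𝓕⁻ (dampedFourier M G) : 𝓢(WithLp 2 (ℝ × E), ℂ)) (WithLp.toLp 2 p))
      (fun M : ℝ => ∫ ζ : WithLp 2 (ℝ × E), Real.fourierChar (inner ℝ ζ (WithLp.toLp 2 p)) •
        ((dampedSymbol M ζ)⁻¹ * 𝓕 G ζ)) (Ioi 0) := by
    intro M hM
    simp only [fourierInv_coe, Real.fourierInv_eq, dampedFourier_apply (mem_Ioi.1 hM)]
  refine ContinuousOn.congr ?_ h1
  have hc : ∀ M : ℝ, 0 < M → Continuous fun ζ : WithLp 2 (ℝ × E) => (dampedSymbol M ζ)⁻¹ :=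
    fun M hM => (hasTemperateGrowth_dampedSymbol_inv hM).1.continuous
  refine continuousOn_of_dominated (bound := fun ζ => ‖𝓕 G ζ‖) ?_ ?_ (𝓕 G).integrable.norm ?_
  · intro M hM
    have h2 := (hc M hM).mul (𝓕 G).continuous
    exact (Continuous.smul (by fun_prop) h2).aestronglyMeasurable
  · intro M hM
    filter_upwards with ζ
    rw [Circle.norm_smul, norm_mul, norm_inv]
    exact mul_le_of_le_one_left (norm_nonneg _)
      (inv_le_one_of_one_le₀ (one_le_norm_dampedSymbol hM ζ))
  · filter_upwards with ζ
    refine ContinuousOn.const_smul (ContinuousOn.mul (ContinuousOn.inv₀ ?_ fun M hM =>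
      dampedSymbol_ne_zero hM ζ) continuousOn_const) _
    unfold dampedSymbol
    fun_prop

end Damped

/-! ### Retarded solutions for test-function sources -/

section CompactSource

open SchwartzMap

variable {E : Type*} [NormedAddCommGroup E] [InnerProductSpace ℝ E] [FiniteDimensional ℝ E]

omit [FiniteDimensional ℝ E] in
theorem exists_expMulSchwartz_eq {f : ℝ × E → ℂ} (hf : ContDiff ℝ ∞ f)
    (hc : HasCompactSupport f) : ∃ G : 𝓢(WithLp 2 (ℝ × E), ℂ), expMulSchwartz G = f := by
  have hexp : ContDiff ℝ ∞ fun p : ℝ × E => (Real.exp (-p.1) : ℂ) :=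
    Complex.ofRealCLM.contDiff.comp (Real.contDiff_exp.comp contDiff_fst.neg)
  have hg : ContDiff ℝ ∞ ((fun p : ℝ × E => (Real.exp (-p.1) : ℂ) * f p) ∘
      WithLp.prodContinuousLinearEquiv 2 ℝ ℝ E) :=
    (hexp.mul hf).comp (WithLp.prodContinuousLinearEquiv 2 ℝ ℝ E).contDiff
  have hgc : HasCompactSupport ((fun p : ℝ × E => (Real.exp (-p.1) : ℂ) * f p) ∘
      WithLp.prodContinuousLinearEquiv 2 ℝ ℝ E) :=
    (HasCompactSupport.mul_left hc).comp_homeomorph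
      (WithLp.prodContinuousLinearEquiv 2 ℝ ℝ E).toHomeomorph
  refine ⟨hgc.toSchwartzMap hg, ?_⟩
  ext p
  rw [expMulSchwartz]
  change (Real.exp p.1 : ℂ) * ((Real.exp (-p.1) : ℂ) * f p) = f p
  rw [← mul_assoc, ← Complex.ofReal_mul, ← Real.exp_add]
  simp

theorem isRetardedSolution_expMulSchwartz [MeasurableSpace E] [BorelSpace E] {M : ℝ} (hM : 0 < M)
    {f : ℝ × E → ℂ} (hc : HasCompactSupport f) {G : 𝓢(WithLp 2 (ℝ × E), ℂ)}
    (hG : expMulSchwartz G = f) :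
    IsRetardedSolution M f (expMulSchwartz (𝓕⁻ (dampedFourier M G))) := by
  refine ⟨?_, fun p => by rw [kleinGordon_expMulSchwartz hM, hG]⟩
  refine isPastCompactSmooth_iff.2 ⟨contDiff_expMulSchwartz _, fun p => ?_⟩
  obtain ⟨T, hT⟩ := (hc.isCompact.image continuous_fst).bddBelow
  refine ⟨T, fun q _ hq => ?_⟩
  -- Raising the tip by half the gap `T - q.1` keeps the cone strictly before the support of the
  -- source.
  refine eq_zero_of_kleinGordon hM (contDiff_expMulSchwartz _) (half_pos (sub_pos.2 hq)) ?_
    (memLp_expMulSchwartz _ _) (fun v => ?_) (fun v w => ?_)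
  · intro r hr
    rw [kleinGordon_expMulSchwartz hM, hG]
    by_contra hne
    have h1 := hT (mem_image_of_mem _ (subset_tsupport _ hne))
    have h2 := causalPast_time_le hr
    simp only at h2
    linarith
  · rw [dirDeriv_expMulSchwartz]; exact memLp_expMulSchwartz _ _
  · rw [dirDeriv_expMulSchwartz, dirDeriv_expMulSchwartz]; exact memLp_expMulSchwartz _ _

/-- Retarded solutions for compactly supported sources, bounded locally uniformly with respect to
the mass and depending continuously on it. -/
theorem exists_isRetardedSolution_of_hasCompactSupport {f : ℝ × E → ℂ} (hf : ContDiff ℝ ∞ f)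
    (hc : HasCompactSupport f) : ∃ Φ : ℝ → ℝ × E → ℂ, (∀ M > 0, IsRetardedSolution M f (Φ M)) ∧
      (∃ C : ℝ, ∀ M > 0, ∀ p, ‖Φ M p‖ ≤ Real.exp p.1 * C) ∧
      ∀ p, ContinuousOn (fun M => Φ M p) (Ioi 0) := by
  borelize E
  obtain ⟨G, hG⟩ := exists_expMulSchwartz_eq hf hc
  exact ⟨fun M => expMulSchwartz (𝓕⁻ (dampedFourier M G)),
    fun M hM => isRetardedSolution_expMulSchwartz hM hc hG,
    ⟨∫ ζ, ‖𝓕 G ζ‖, fun M hM p => norm_expMulSchwartz_le hM G p⟩, continuousOn_expMulSchwartz G⟩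

end CompactSource

/-! ### Retarded solutions and propagators for past-compact sources -/

section Retarded

theorem causalPast_later_mem {E : Type*} [NormedAddCommGroup E] {p q : ℝ × E}
    (hq : q ∈ causalPast p) {δ ε : ℝ} (h : δ ≤ ε) :
    (q.1 + δ, q.2) ∈ causalPast (p.1 + ε, p.2) := by
  have : ‖p.2 - q.2‖ ≤ p.1 - q.1 := hq
  simp only [causalPast, mem_ofPred_eq]
  linarith

variable {E : Type*} [NormedAddCommGroup E] [InnerProductSpace ℝ E] [FiniteDimensional ℝ E]

theorem IsRetardedSolution.sub {M : ℝ} {φ φ' ψ ψ' : ℝ × E → ℂ} (h : IsRetardedSolution M φ ψ)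
    (h' : IsRetardedSolution M φ' ψ') :
    IsRetardedSolution M (fun p => φ p - φ' p) (fun p => ψ p - ψ' p) := by
  refine ⟨h.1.sub h'.1, fun p => ?_⟩
  rw [dAlembertian_sub h.1.1 h'.1.1]
  linear_combination h.2 p - h'.2 p

theorem isRetardedSolution_zero (M : ℝ) :
    IsRetardedSolution M (fun _ : ℝ × E => (0 : ℂ)) (fun _ => 0) := by
  refine ⟨isPastCompactSmooth_zero, fun p => ?_⟩
  have := dAlembertian_const_mul (contDiff_const : ContDiff ℝ ∞ fun _ : ℝ × E => (0 : ℂ)) 0 p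
  simpa using this

theorem IsRetardedSolution.dirDeriv {M : ℝ} {φ ψ : ℝ × E → ℂ} (h : IsRetardedSolution M φ ψ)
    (v : ℝ × E) : IsRetardedSolution M (dirDeriv v φ) (dirDeriv v ψ) := by
  refine ⟨h.1.dirDeriv v, fun p => ?_⟩
  have hc : ContDiff ℝ ∞ fun p => (M : ℂ) * ψ p := contDiff_const.mul h.1.1
  rw [← show (fun p => dAlembertian ψ p - M * ψ p) = φ from funext h.2,
    dirDeriv_sub h.1.1.dAlembertian.differentiable_infty hc.differentiable_infty,
    dirDeriv_dAlembertian h.1.1, dirDeriv_const_mul h.1.1.differentiable_infty]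

theorem IsRetardedSolution.dAlembertian {M : ℝ} {φ ψ : ℝ × E → ℂ} (h : IsRetardedSolution M φ ψ) :
    IsRetardedSolution M (dAlembertian φ) (dAlembertian ψ) := by
  refine ⟨h.1.dAlembertian, fun p => ?_⟩
  have hc : ContDiff ℝ ∞ fun p => (M : ℂ) * ψ p := contDiff_const.mul h.1.1
  rw [← show (fun p => _root_.dAlembertian ψ p - M * ψ p) = φ from funext h.2,
    dAlembertian_sub h.1.1.dAlembertian hc, dAlembertian_const_mul h.1.1]

/-- Retarded solutions depend on the source in the causal past only. -/
theorem IsRetardedSolution.eq_of_eqOn_causalPast {M : ℝ} (hM : 0 < M) {φ φ' ψ ψ' : ℝ × E → ℂ}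
    (h : IsRetardedSolution M φ ψ) (h' : IsRetardedSolution M φ' ψ') {q : ℝ × E} {δ : ℝ}
    (hδ : 0 < δ) (heq : EqOn φ φ' (causalPast (q.1 + δ, q.2))) : ψ q = ψ' q := by
  have hs := h.sub h'
  refine sub_eq_zero.1 (hs.1.eq_zero_of_kleinGordon hM hδ fun p hp => ?_)
  rw [hs.2 p]
  exact sub_eq_zero.2 (heq hp)

theorem IsRetardedSolution.unique {M : ℝ} (hM : 0 < M) {φ ψ ψ' : ℝ × E → ℂ}
    (h : IsRetardedSolution M φ ψ) (h' : IsRetardedSolution M φ ψ') : ψ = ψ' :=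
  funext fun _ => h.eq_of_eqOn_causalPast hM h' one_pos fun _ _ => rfl

theorem IsRetardedSolution.eq_zero_of_time_lt {M : ℝ} (hM : 0 < M) {φ ψ : ℝ × E → ℂ}
    (h : IsRetardedSolution M φ ψ) {p : ℝ × E} {T : ℝ}
    (hT : ∀ q ∈ causalPast (p.1 + 1, p.2), q.1 < T → φ q = 0) {q : ℝ × E} (hq : q ∈ causalPast p)
    (hlt : q.1 < T) : ψ q = 0 := by
  -- The bound `1` keeps the raised cone inside the one of the hypothesis; the other bound keeps it
  -- before `T`.
  set δ := min 1 ((T - q.1) / 2) with hδ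
  have hpos : 0 < δ := lt_min one_pos (by linarith)
  refine h.eq_of_eqOn_causalPast hM (isRetardedSolution_zero M) hpos fun r hr => ?_
  refine hT r (causalPast_trans (causalPast_later_mem hq (min_le_left _ _)) hr) ?_
  have h1 := causalPast_time_le hr
  have h2 : δ ≤ (T - q.1) / 2 := min_le_right _ _
  simp only at h1
  linarith

/-- A past-compact smooth function agrees in a given causal past with a test function. -/
theorem IsPastCompactSmooth.exists_hasCompactSupport {φ : ℝ × E → ℂ} (hφ : IsPastCompactSmooth φ)
    (p : ℝ × E) : ∃ f : ℝ × E → ℂ, ContDiff ℝ ∞ f ∧ HasCompactSupport f ∧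
      EqOn f φ (causalPast p) := by
  obtain ⟨R, hR⟩ := (hφ.2 p).isBounded.subset_closedBall (0 : ℝ × E)
  let χ : ContDiffBump (0 : ℝ × E) :=
    ⟨max R 1, 2 * max R 1, by positivity, by linarith [le_max_right R 1]⟩
  refine ⟨fun q => (χ q : ℂ) * φ q, (Complex.ofRealCLM.contDiff.comp χ.contDiff).mul hφ.1, ?_, ?_⟩
  · exact (χ.hasCompactSupport.comp_left (g := Complex.ofReal) rfl).mul_right
  · intro q hq
    by_cases hs : q ∈ tsupport φ
    · have h1 : χ q = 1 := χ.one_of_mem_closedBall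
        (Metric.closedBall_subset_closedBall (le_max_left _ _) (hR ⟨hq, hs⟩))
      simp [h1]
    · simp [image_eq_zero_of_notMem_tsupport hs]

/-- Retarded solutions for past-compact sources, bounded locally uniformly with respect to the
mass and depending continuously on it. -/
theorem IsPastCompactSmooth.exists_isRetardedSolution {φ : ℝ × E → ℂ}
    (hφ : IsPastCompactSmooth φ) : ∃ Ψ : ℝ → ℝ × E → ℂ, (∀ M > 0, IsRetardedSolution M φ (Ψ M)) ∧
      (∀ q₀, ∃ U ∈ 𝓝 q₀, ∃ C : ℝ, ∀ M > 0, ∀ q ∈ U, ‖Ψ M q‖ ≤ C) ∧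
      ∀ q, ContinuousOn (fun M => Ψ M q) (Ioi 0) := by
  -- The causal pasts of the events `(n, 0)` exhaust spacetime, and in each of them `φ` agrees with
  -- a test function.
  choose f hf hfc hfe using fun n : ℕ => hφ.exists_hasCompactSupport ((n : ℝ), (0 : E))
  choose Φ hΦall using fun n : ℕ =>
    exists_isRetardedSolution_of_hasCompactSupport (hf n) (hfc n)
  have hΦ := fun n => (hΦall n).1
  have hΦc := fun n => (hΦall n).2.2
  choose C hC using fun n => (hΦall n).2.1
  -- `N q` is large enough for the cone below `(q.1 + 1, q.2)` to lie in that of `(N q, 0)`; the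
  -- extra `1` is the room the uniqueness statement needs.
  let N : ℝ × E → ℕ := fun q => ⌈q.1 + ‖q.2‖ + 1⌉₊
  have hN : ∀ q : ℝ × E, q.1 + ‖q.2‖ + 1 ≤ N q := fun q => Nat.le_ceil _
  have hsub : ∀ (q : ℝ × E) (n : ℕ), q.1 + ‖q.2‖ + 1 ≤ n →
      EqOn (f n) φ (causalPast (q.1 + 1, q.2)) := by
    intro q n hn r hr
    refine hfe n (causalPast_trans ?_ hr)
    simp only [causalPast, mem_ofPred_eq, zero_sub, norm_neg]
    linarith
  have hind : ∀ M > 0, ∀ (q : ℝ × E) (n : ℕ), q.1 + ‖q.2‖ + 1 ≤ n → Φ (N q) M q = Φ n M q := by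
    intro M hM q n hn
    exact (hΦ _ M hM).eq_of_eqOn_causalPast hM (hΦ _ M hM) one_pos
      ((hsub q _ (hN q)).trans (hsub q n hn).symm)
  have hnear : ∀ q₀ : ℝ × E, ∃ n : ℕ, ∃ U ∈ 𝓝 q₀, ∀ q ∈ U, q.1 + ‖q.2‖ + 1 ≤ n := by
    intro q₀
    refine ⟨N q₀ + 1, {q : ℝ × E | q.1 + ‖q.2‖ + 1 < (N q₀ + 1 : ℕ)}, ?_, fun q hq => le_of_lt hq⟩
    refine (isOpen_lt (by fun_prop) continuous_const).mem_nhds ?_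
    have := hN q₀
    simp only [mem_ofPred_eq]
    push_cast
    linarith
  -- `N` jumps, but any larger index gives the same value, so near each point the glued function is
  -- a single `Φ n M`.
  have hev : ∀ M > 0, ∀ q₀ : ℝ × E, ∃ n : ℕ, q₀.1 + ‖q₀.2‖ + 1 ≤ n ∧
      (fun q => Φ (N q) M q) =ᶠ[𝓝 q₀] Φ n M := by
    intro M hM q₀
    obtain ⟨n, U, hU, hn⟩ := hnear q₀
    exact ⟨n, hn _ (mem_of_mem_nhds hU), by filter_upwards [hU] with q hq using hind M hM q n (hn q hq)⟩
  refine ⟨fun M q => Φ (N q) M q, fun M hM => ?_, fun q₀ => ?_, fun q => hΦc _ q⟩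
  · have hsm : ContDiff ℝ ∞ fun q => Φ (N q) M q := by
      rw [contDiff_iff_contDiffAt]
      intro q₀
      obtain ⟨n, -, hn⟩ := hev M hM q₀
      exact (hΦ n M hM).1.1.contDiffAt.congr_of_eventuallyEq hn
    refine ⟨isPastCompactSmooth_iff.2 ⟨hsm, fun p => ?_⟩, fun q₀ => ?_⟩
    · obtain ⟨T, hT⟩ := (isPastCompactSmooth_iff.1 (hΦ (N p) M hM).1).2 p
      refine ⟨T, fun q hq hlt => ?_⟩
      refine (hind M hM q (N p) ?_).trans (hT q hq hlt)
      have h1 : ‖p.2 - q.2‖ ≤ p.1 - q.1 := hq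
      have h2 : ‖q.2‖ ≤ ‖p.2‖ + ‖p.2 - q.2‖ := by
        have := norm_sub_le p.2 (p.2 - q.2)
        rwa [sub_sub_cancel] at this
      linarith [hN p]
    · obtain ⟨n, hle, hn⟩ := hev M hM q₀
      have h1 := (hΦ n M hM).2 q₀
      rw [← dAlembertian_congr hsm (hΦ n M hM).1.1 hn, ← hn.eq_of_nhds] at h1
      exact h1.trans (hsub q₀ n hle (by simp [causalPast]))
  · obtain ⟨n, U, hU, hn⟩ := hnear q₀
    have hV : {q : ℝ × E | q.1 < q₀.1 + 1} ∈ 𝓝 q₀ :=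
      (isOpen_lt continuous_fst continuous_const).mem_nhds (by simp)
    refine ⟨U ∩ {q : ℝ × E | q.1 < q₀.1 + 1}, inter_mem hU hV, Real.exp (q₀.1 + 1) * |C n|,
      fun M hM q hq => ?_⟩
    refine (congrArg norm (hind M hM q n (hn q hq.1))).trans_le ((hC n M hM q).trans ?_)
    exact mul_le_mul (Real.exp_le_exp.2 (le_of_lt hq.2)) (le_abs_self _)
      (by
        by_contra hneg
        have h0 := (norm_nonneg _).trans (hC n M hM q)
        exact absurd h0 (not_le.2 (mul_neg_of_pos_of_neg (Real.exp_pos _) (not_le.1 hneg))))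
      (Real.exp_nonneg _)

theorem IsPastCompactSmooth.existsUnique_isRetardedSolution {φ : ℝ × E → ℂ}
    (hφ : IsPastCompactSmooth φ) {M : ℝ} (hM : 0 < M) : ∃! ψ, IsRetardedSolution M φ ψ := by
  obtain ⟨Ψ, h, -⟩ := hφ.exists_isRetardedSolution
  exact ⟨Ψ M, h M hM, fun ψ hψ => hψ.unique hM (h M hM)⟩

theorem IsPastCompactSmooth.isRetardedSolution_retardedPropagator {φ : ℝ × E → ℂ}
    (hφ : IsPastCompactSmooth φ) {M : ℝ} (hM : 0 < M) :
    IsRetardedSolution M φ (retardedPropagator M φ) := by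
  have h := hφ.existsUnique_isRetardedSolution hM
  rw [retardedPropagator, dif_pos h]
  exact h.choose_spec.1

theorem IsRetardedSolution.eq_retardedPropagator {φ ψ : ℝ × E → ℂ} (hφ : IsPastCompactSmooth φ)
    {M : ℝ} (hM : 0 < M) (h : IsRetardedSolution M φ ψ) : ψ = retardedPropagator M φ :=
  h.unique hM (hφ.isRetardedSolution_retardedPropagator hM)

theorem continuousOn_retardedPropagator {φ : ℝ × E → ℂ} (hφ : IsPastCompactSmooth φ) (q : ℝ × E) :
    ContinuousOn (fun M => retardedPropagator M φ q) (Ioi 0) := by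
  obtain ⟨Ψ, h, -, hc⟩ := hφ.exists_isRetardedSolution
  exact (hc q).congr fun M hM => congrFun ((h M hM).eq_retardedPropagator hφ hM).symm q

theorem retardedPropagator_locally_bounded {φ : ℝ × E → ℂ} (hφ : IsPastCompactSmooth φ)
    (q₀ : ℝ × E) : ∃ U ∈ 𝓝 q₀, ∃ C : ℝ, ∀ M > 0, ∀ q ∈ U, ‖retardedPropagator M φ q‖ ≤ C := by
  obtain ⟨Ψ, h, hb, -⟩ := hφ.exists_isRetardedSolution
  obtain ⟨U, hU, C, hC⟩ := hb q₀
  exact ⟨U, hU, C, fun M hM q hq => (h M hM).eq_retardedPropagator hφ hM ▸ hC M hM q hq⟩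

/-- Constant-coefficient operators commute, so the derivative of a retarded solution is the retarded
solution for the differentiated source; uniqueness does the rest. -/
theorem dirDeriv_retardedPropagator {φ : ℝ × E → ℂ} (hφ : IsPastCompactSmooth φ) {M : ℝ}
    (hM : 0 < M) (v : ℝ × E) :
    dirDeriv v (retardedPropagator M φ) = retardedPropagator M (dirDeriv v φ) :=
  ((hφ.isRetardedSolution_retardedPropagator hM).dirDeriv v).eq_retardedPropagator (hφ.dirDeriv v)
    hM

theorem dAlembertian_retardedPropagator {φ : ℝ × E → ℂ} (hφ : IsPastCompactSmooth φ) {M : ℝ}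
    (hM : 0 < M) :
    dAlembertian (retardedPropagator M φ) = retardedPropagator M (dAlembertian φ) :=
  ((hφ.isRetardedSolution_retardedPropagator hM).dAlembertian).eq_retardedPropagator
    hφ.dAlembertian hM

/-- The retarded propagator decays like the inverse mass, locally uniformly. -/
theorem retardedPropagator_locally_le_div {φ : ℝ × E → ℂ} (hφ : IsPastCompactSmooth φ)
    (q₀ : ℝ × E) : ∃ U ∈ 𝓝 q₀, ∃ C : ℝ, 0 ≤ C ∧
      ∀ M > 0, ∀ q ∈ U, ‖retardedPropagator M φ q‖ ≤ C / M := by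
  obtain ⟨U, hU, C, hC⟩ := retardedPropagator_locally_bounded hφ.dAlembertian q₀
  have hV : {q | ‖φ q‖ < ‖φ q₀‖ + 1} ∈ 𝓝 q₀ :=
    (isOpen_lt hφ.1.continuous.norm continuous_const).mem_nhds (by simp)
  refine ⟨U ∩ {q | ‖φ q‖ < ‖φ q₀‖ + 1}, inter_mem hU hV, |C| + (‖φ q₀‖ + 1), by positivity,
    fun M hM q hq => ?_⟩
  -- The equation reads `Mψ = G^M(□φ) - φ`, and both terms are bounded near `q₀` independently of
  -- `M`.
  have h := (hφ.isRetardedSolution_retardedPropagator hM).2 q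
  rw [dAlembertian_retardedPropagator hφ hM] at h
  rw [le_div_iff₀ hM]
  calc ‖retardedPropagator M φ q‖ * M = ‖(M : ℂ) * retardedPropagator M φ q‖ := by
        rw [norm_mul, Complex.norm_real, Real.norm_of_nonneg hM.le, mul_comm]
    _ = ‖retardedPropagator M (dAlembertian φ) q - φ q‖ := by
        rw [← h]; congr 1; ring
    _ ≤ ‖retardedPropagator M (dAlembertian φ) q‖ + ‖φ q‖ := norm_sub_le _ _
    _ ≤ |C| + (‖φ q₀‖ + 1) :=
        add_le_add ((hC M hM q hq.1).trans (le_abs_self _)) (le_of_lt hq.2)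

/-- The retarded propagators vanish in the past, uniformly with respect to the mass. -/
theorem exists_retardedPropagator_eq_zero {φ : ℝ × E → ℂ} (hφ : IsPastCompactSmooth φ)
    (p : ℝ × E) : ∃ T : ℝ, ∀ M > 0, ∀ q ∈ causalPast p, q.1 < T → retardedPropagator M φ q = 0 := by
  obtain ⟨T, hT⟩ := (isPastCompactSmooth_iff.1 hφ).2 (p.1 + 1, p.2)
  exact ⟨T, fun M hM q hq hlt =>
    (hφ.isRetardedSolution_retardedPropagator hM).eq_zero_of_time_lt hM hT hq hlt⟩

end Retarded

/-! ### Smoothness of parametric integrals -/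

section ParametricIntegral

/-- A collection of families of smooth functions, each locally dominated by an integrable function
of the parameter, which is closed under directional derivatives up to sums. -/
structure IsDerivClosed {ι P X : Type*} [MeasurableSpace P] [NormedAddCommGroup X]
    [NormedSpace ℝ X] (μ : Measure P) (F : ι → P → X → ℂ) : Prop where
  contDiff : ∀ i, ∀ᵐ p ∂μ, ContDiff ℝ ∞ (F i p)
  aestronglyMeasurable : ∀ i x, AEStronglyMeasurable (fun p => F i p x) μ
  dominated : ∀ i x, ∃ U ∈ 𝓝 x, ∃ g : P → ℝ, Integrable g μ ∧ ∀ᵐ p ∂μ, ∀ y ∈ U, ‖F i p y‖ ≤ g p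
  deriv : ∀ i v, ∃ j k, ∀ᵐ p ∂μ, dirDeriv v (F i p) = fun x => F j p x + F k p x

variable {ι P X : Type*} [MeasurableSpace P] [NormedAddCommGroup X] [NormedSpace ℝ X]
  {μ : Measure P} {F : ι → P → X → ℂ}

theorem IsDerivClosed.integrable (h : IsDerivClosed μ F) (i : ι) (x : X) :
    Integrable (fun p => F i p x) μ := by
  obtain ⟨U, hU, g, hg, hb⟩ := h.dominated i x
  exact hg.mono' (h.aestronglyMeasurable i x)
    (by filter_upwards [hb] with p hp using hp x (mem_of_mem_nhds hU))

theorem IsDerivClosed.integrable_dirDeriv (h : IsDerivClosed μ F) (i : ι) (v x : X) :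
    Integrable (fun p => dirDeriv v (F i p) x) μ := by
  obtain ⟨j, k, hjk⟩ := h.deriv i v
  refine ((h.integrable j x).add (h.integrable k x)).congr ?_
  filter_upwards [hjk] with p hp
  rw [hp]; rfl

theorem IsDerivClosed.dominated_dirDeriv (h : IsDerivClosed μ F) (i : ι) (v x : X) :
    ∃ U ∈ 𝓝 x, ∃ g : P → ℝ, Integrable g μ ∧ ∀ᵐ p ∂μ, ∀ y ∈ U, ‖dirDeriv v (F i p) y‖ ≤ g p := by
  obtain ⟨j, k, hjk⟩ := h.deriv i v
  obtain ⟨U, hU, g, hg, hb⟩ := h.dominated j x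
  obtain ⟨V, hV, g', hg', hb'⟩ := h.dominated k x
  refine ⟨U ∩ V, inter_mem hU hV, fun p => g p + g' p, hg.add hg', ?_⟩
  filter_upwards [hjk, hb, hb'] with p h1 h2 h3 y hy
  rw [h1]
  exact (norm_add_le _ _).trans (add_le_add (h2 y hy.1) (h3 y hy.2))

variable [FiniteDimensional ℝ X]

theorem IsDerivClosed.hasFDerivAt_integral (h : IsDerivClosed μ F) (i : ι) (x : X) :
    ∃ L : X →L[ℝ] ℂ, HasFDerivAt (fun x => ∫ p, F i p x ∂μ) L x ∧
      ∀ v, L v = ∫ p, dirDeriv v (F i p) x ∂μ := by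
  let B := Module.finBasis ℝ X
  let c : Fin (Module.finrank ℝ X) → X →L[ℝ] ℝ := fun a => LinearMap.toContinuousLinearMap (B.coord a)
  -- Expanding in a basis reduces measurability and domination of the full derivative to finitely
  -- many directional ones.
  have hrep : ∀ L : X →L[ℝ] ℂ, L = ∑ a, (c a).smulRight (L (B a)) := by
    intro L
    ext v
    have h1 := congrArg L (B.sum_repr v)
    rw [map_sum] at h1
    simp only [map_smul] at h1
    rw [← h1]
    simp [c]
  choose U hU g hg hb using fun a => h.dominated_dirDeriv i (B a) x
  have hint : Integrable (fun p => ∑ a, ‖c a‖ * g a p) μ :=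
    integrable_finsetSum _ fun a _ => (hg a).const_mul _
  have hmeas : AEStronglyMeasurable (fun p => fderiv ℝ (F i p) x) μ := by
    have h2 : (fun p => fderiv ℝ (F i p) x) =
        fun p => ∑ a, (ContinuousLinearMap.smulRightL ℝ X ℂ (c a)) (dirDeriv (B a) (F i p) x) := by
      ext1 p
      exact hrep _
    rw [h2]
    exact Finset.aestronglyMeasurable_fun_sum _ fun a _ =>
      (ContinuousLinearMap.continuous _).comp_aestronglyMeasurable
        (h.integrable_dirDeriv i (B a) x).1
  have hall : ∀ᵐ p ∂μ, ∀ a, ∀ y ∈ U a, ‖dirDeriv (B a) (F i p) y‖ ≤ g a p := ae_all_iff.2 hb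
  have hbound : ∀ᵐ p ∂μ, ∀ y ∈ ⋂ a, U a, ‖fderiv ℝ (F i p) y‖ ≤ ∑ a, ‖c a‖ * g a p := by
    filter_upwards [hall] with p hp y hy
    rw [hrep (fderiv ℝ (F i p) y)]
    refine (norm_sum_le _ _).trans (Finset.sum_le_sum fun a _ => ?_)
    rw [ContinuousLinearMap.norm_smulRight_apply]
    exact mul_le_mul_of_nonneg_left (hp a y (mem_iInter.1 hy a)) (norm_nonneg _)
  have hnhds : (⋂ a, U a) ∈ 𝓝 x := iInter_mem.2 hU
  have key := hasFDerivAt_integral_of_dominated_of_fderiv_le hnhds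
    (Eventually.of_forall fun y => h.aestronglyMeasurable i y) (h.integrable i x) hmeas hbound hint
    (by filter_upwards [h.contDiff i] with p hp y _
          using (hp.differentiable_infty y).hasFDerivAt)
  refine ⟨_, key, fun v => ?_⟩
  have hi : Integrable (fun p => fderiv ℝ (F i p) x) μ :=
    hint.mono' hmeas (by filter_upwards [hbound] with p hp using hp x (mem_of_mem_nhds hnhds))
  exact ContinuousLinearMap.integral_apply hi v

theorem IsDerivClosed.dirDeriv_integral (h : IsDerivClosed μ F) (i : ι) (v : X) :
    dirDeriv v (fun x => ∫ p, F i p x ∂μ) = fun x => ∫ p, dirDeriv v (F i p) x ∂μ := by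
  ext x
  obtain ⟨L, hL, hv⟩ := h.hasFDerivAt_integral i x
  rw [← hv v, dirDeriv, hL.fderiv]

theorem IsDerivClosed.integral_dirDeriv_eq_add (h : IsDerivClosed μ F) (i : ι) (v : X) :
    ∃ j k, (∀ᵐ p ∂μ, dirDeriv v (F i p) = fun x => F j p x + F k p x) ∧
      dirDeriv v (fun x => ∫ p, F i p x ∂μ) =
        fun x => (∫ p, F j p x ∂μ) + ∫ p, F k p x ∂μ := by
  obtain ⟨j, k, hjk⟩ := h.deriv i v
  refine ⟨j, k, hjk, ?_⟩
  rw [h.dirDeriv_integral]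
  ext x
  rw [← integral_add (h.integrable j x) (h.integrable k x)]
  refine integral_congr_ae ?_
  filter_upwards [hjk] with p hp
  rw [hp]

/-- A directional derivative of the integral is a sum of two integrals from the same collection, so
induction on the order needs only first derivatives under the integral. -/
theorem IsDerivClosed.contDiff_integral (h : IsDerivClosed μ F) (i : ι) :
    ContDiff ℝ ∞ (fun x => ∫ p, F i p x ∂μ) := by
  have hdiff : ∀ i, Differentiable ℝ (fun x => ∫ p, F i p x ∂μ) := fun i x =>
    (h.hasFDerivAt_integral i x).choose_spec.1.differentiableAt
  rw [contDiff_infty]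
  intro n
  induction n generalizing i with
  | zero => exact contDiff_zero.2 (hdiff i).continuous
  | succ n ih =>
    rw [Nat.cast_succ, contDiff_succ_iff_fderiv_apply]
    refine ⟨hdiff i, fun hω => absurd hω (by simp), fun v => ?_⟩
    obtain ⟨j, k, -, hjk⟩ := h.integral_dirDeriv_eq_add i v
    change ContDiff ℝ n (dirDeriv v fun x => ∫ p, F i p x ∂μ)
    rw [hjk]
    exact (ih j).add (ih k)

theorem IsDerivClosed.dirDeriv_dirDeriv_integral (h : IsDerivClosed μ F) (i : ι) (w v x : X) :
    Integrable (fun p => dirDeriv w (dirDeriv v (F i p)) x) μ ∧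
    dirDeriv w (dirDeriv v (fun x => ∫ p, F i p x ∂μ)) x =
      ∫ p, dirDeriv w (dirDeriv v (F i p)) x ∂μ := by
  obtain ⟨j, k, hp, hjk⟩ := h.integral_dirDeriv_eq_add i v
  have hae : (fun p => dirDeriv w (F j p) x + dirDeriv w (F k p) x) =ᵐ[μ]
      fun p => dirDeriv w (dirDeriv v (F i p)) x := by
    filter_upwards [hp, h.contDiff j, h.contDiff k] with p h1 h2 h3
    rw [h1, dirDeriv_add h2.differentiable_infty h3.differentiable_infty]
  refine ⟨((h.integrable_dirDeriv j w x).add (h.integrable_dirDeriv k w x)).congr hae, ?_⟩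
  rw [hjk, dirDeriv_add (h.contDiff_integral j).differentiable_infty
    (h.contDiff_integral k).differentiable_infty, h.dirDeriv_integral, h.dirDeriv_integral]
  exact (integral_add (h.integrable_dirDeriv j w x) (h.integrable_dirDeriv k w x)).symm.trans
    (integral_congr_ae hae)

theorem IsDerivClosed.dAlembertian_integral {E : Type*} [NormedAddCommGroup E]
    [InnerProductSpace ℝ E] [FiniteDimensional ℝ E] {F : ι → P → ℝ × E → ℂ}
    (h : IsDerivClosed μ F) (i : ι) (x : ℝ × E) :
    dAlembertian (fun x => ∫ p, F i p x ∂μ) x = ∫ p, dAlembertian (F i p) x ∂μ := by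
  have h2 := fun v => h.dirDeriv_dirDeriv_integral i v v x
  rw [dAlembertian_eq (stdOrthonormalBasis ℝ E) (h.contDiff_integral i), (h2 _).2,
    Finset.sum_congr rfl fun a _ => (h2 _).2, ← integral_neg,
    ← integral_finsetSum _ fun a _ => (h2 _).1,
    ← integral_add (h2 _).1.fun_neg (integrable_finsetSum _ fun a _ => (h2 _).1)]
  refine integral_congr_ae ?_
  filter_upwards [h.contDiff i] with p hp
  rw [dAlembertian_eq (stdOrthonormalBasis ℝ E) hp]

end ParametricIntegral

/-! ### The integral over the masses -/

section SpectralIntegral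

theorem norm_rhoDensity_le {m M : ℝ} (hM : 4 * m ^ 2 < M) : ‖rhoDensity m M‖ ≤ 1 / M := by
  have hM0 : 0 < M := lt_of_le_of_lt (by positivity) hM
  have h1 : √(1 - 4 * m ^ 2 / M) ≤ 1 :=
    Real.sqrt_le_one.2 (by have : 0 ≤ 4 * m ^ 2 / M := by positivity
                           linarith)
  have h2 : 1 / (16 * Real.pi ^ 2) ≤ 1 := by
    rw [div_le_one (by positivity)]
    nlinarith [Real.pi_gt_three]
  have h0 : 0 ≤ √(1 - 4 * m ^ 2 / M) := Real.sqrt_nonneg _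
  unfold rhoDensity
  rw [Real.norm_of_nonneg (by positivity)]
  refine mul_le_of_le_one_left (by positivity) (mul_le_one₀ h2 h0 h1)

theorem measurable_rhoDensity (m : ℝ) : Measurable (rhoDensity m) := by
  unfold rhoDensity; fun_prop

/-- Both `ρ(M)` and `G^M(φ)` are `O(1/M)`, so `M⁻²` dominates. Indexing by all past-compact sources
closes the collection, since differentiation only replaces `φ` by its derivative. -/
theorem isDerivClosed_spectral {m : ℝ} (hm : 0 < m) :
    IsDerivClosed (volume.restrict (Ioi (4 * m ^ 2)))
      (fun (φ : {φ : Mink4 → ℂ // IsPastCompactSmooth φ}) (M : ℝ) (q : Mink4) =>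
        (rhoDensity m M : ℂ) * retardedPropagator M φ.1 q) := by
  have h0 : (0 : ℝ) < 4 * m ^ 2 := by positivity
  have hae : ∀ᵐ M ∂(volume.restrict (Ioi (4 * m ^ 2))), 4 * m ^ 2 < M :=
    ae_restrict_mem measurableSet_Ioi
  refine ⟨fun φ => ?_, fun φ q => ?_, fun φ q => ?_, fun φ v => ?_⟩
  · filter_upwards [hae] with M hM
    exact contDiff_const.mul (φ.2.isRetardedSolution_retardedPropagator (h0.trans hM)).1.1
  · refine (Complex.measurable_ofReal.comp (measurable_rhoDensity m)).aestronglyMeasurable.mul ?_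
    exact ((continuousOn_retardedPropagator φ.2 q).mono fun M hM => h0.trans hM).aestronglyMeasurable
      measurableSet_Ioi
  · obtain ⟨U, hU, C, hC0, hC⟩ := retardedPropagator_locally_le_div φ.2 q
    refine ⟨U, hU, fun M => C * M ^ (-2 : ℝ),
      (integrableOn_Ioi_rpow_of_lt (by norm_num) h0).const_mul C, ?_⟩
    filter_upwards [hae] with M hM y hy
    have hM0 := h0.trans hM
    rw [norm_mul, Complex.norm_real]
    calc _ ≤ 1 / M * (C / M) := mul_le_mul (norm_rhoDensity_le hM) (hC M hM0 y hy)
          (norm_nonneg _) (by positivity)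
      _ = C * M ^ (-2 : ℝ) := by
          rw [Real.rpow_neg hM0.le, Real.rpow_two]; field_simp
  -- One term suffices here; the zero source fills the second slot.
  · refine ⟨⟨_, φ.2.dirDeriv v⟩, ⟨_, isPastCompactSmooth_zero⟩, ?_⟩
    filter_upwards [hae] with M hM
    have hM0 := h0.trans hM
    have hz := (isRetardedSolution_zero (E := Space3) M).eq_retardedPropagator
      isPastCompactSmooth_zero hM0
    rw [dirDeriv_const_mul (φ.2.isRetardedSolution_retardedPropagator hM0).1.1.differentiable_infty,
      dirDeriv_retardedPropagator φ.2 hM0, ← hz]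
    simp

theorem isPastCompactSmooth_spectralIntegral {m : ℝ} (hm : 0 < m) {φ : Mink4 → ℂ}
    (hφ : IsPastCompactSmooth φ) : IsPastCompactSmooth (spectralIntegral m φ) := by
  refine isPastCompactSmooth_iff.2
    ⟨(isDerivClosed_spectral hm).contDiff_integral ⟨φ, hφ⟩, fun p => ?_⟩
  obtain ⟨T, hT⟩ := exists_retardedPropagator_eq_zero hφ p
  refine ⟨T, fun q hq hlt => setIntegral_eq_zero_of_forall_eq_zero fun M hM => ?_⟩
  rw [hT M (lt_trans (by positivity) (mem_Ioi.1 hM)) q hq hlt, mul_zero]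

theorem nonlocalK0_eq_spectralIntegral {m : ℝ} (hm : 0 < m) {φ : Mink4 → ℂ}
    (hφ : IsPastCompactSmooth φ) : nonlocalK0 m φ = spectralIntegral m (dAlembertian φ) := by
  ext q
  refine ((isDerivClosed_spectral hm).dAlembertian_integral ⟨φ, hφ⟩ q).trans ?_
  refine setIntegral_congr_fun measurableSet_Ioi fun M hM => ?_
  have hM0 : 0 < M := lt_trans (by positivity) (mem_Ioi.1 hM)
  simp only
  rw [dAlembertian_const_mul (hφ.isRetardedSolution_retardedPropagator hM0).1.1,
    dAlembertian_retardedPropagator hφ hM0]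

end SpectralIntegral

/-! ### Plane waves in the fifth coordinate -/

section PlaneWave

/-- The projection `𝓜₅ → 𝓜`. -/
def toMink4 : Mink5 →L[ℝ] Mink4 :=
  (ContinuousLinearMap.fst ℝ ℝ Space4).prod
    ((WithLp.fstL 2 ℝ Space3 ℝ).comp (ContinuousLinearMap.snd ℝ ℝ Space4))

/-- The fifth coordinate on `𝓜₅`. -/
def fifthCoord : Mink5 →L[ℝ] ℝ :=
  (WithLp.sndL 2 ℝ Space3 ℝ).comp (ContinuousLinearMap.snd ℝ ℝ Space4)

theorem tensorFun_eq (φ : Mink4 → ℂ) (h : ℝ → ℂ) (q : Mink5) :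
    tensorFun φ h q = φ (toMink4 q) * h (fifthCoord q) := rfl

theorem toMink4_mem_causalPast {p q : Mink5} (hq : q ∈ causalPast p) :
    toMink4 q ∈ causalPast (toMink4 p) := by
  have h1 : ‖p.2 - q.2‖ ≤ p.1 - q.1 := hq
  exact (WithLp.norm_fst_le _ (p.2 - q.2)).trans h1

theorem isPastCompactSmooth_tensorFun {φ : Mink4 → ℂ} (hφ : IsPastCompactSmooth φ) {h : ℝ → ℂ}
    (hh : ContDiff ℝ ∞ h) : IsPastCompactSmooth (tensorFun φ h) := by
  refine isPastCompactSmooth_iff.2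
    ⟨(hφ.1.comp toMink4.contDiff).mul (hh.comp fifthCoord.contDiff), fun p => ?_⟩
  obtain ⟨T, hT⟩ := (isPastCompactSmooth_iff.1 hφ).2 (toMink4 p)
  refine ⟨T, fun q hq hlt => ?_⟩
  rw [tensorFun_eq, hT _ (toMink4_mem_causalPast hq) hlt, zero_mul]

/-- The plane wave `e^{2πipz}` on the real line. -/
def planeWave (p z : ℝ) : ℂ := Complex.exp (2 * Real.pi * Complex.I * p * z)

theorem norm_planeWave (p z : ℝ) : ‖planeWave p z‖ = 1 := by
  rw [planeWave, show (2 * Real.pi * Complex.I * p * z : ℂ) = ((2 * Real.pi * p * z : ℝ) : ℂ) *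
    Complex.I by push_cast; ring]
  exact Complex.norm_exp_ofReal_mul_I _

theorem continuous_planeWave_left (z : ℝ) : Continuous fun p => planeWave p z := by
  unfold planeWave; fun_prop

theorem contDiff_planeWave (p : ℝ) : ContDiff ℝ ∞ (planeWave p) := by
  unfold planeWave
  exact (contDiff_const.mul Complex.ofRealCLM.contDiff).cexp

theorem dirDeriv_planeWave_fifthCoord (p : ℝ) (v : Mink5) :
    dirDeriv v (fun q => planeWave p (fifthCoord q)) =
      fun q => 2 * Real.pi * Complex.I * p * fifthCoord v * planeWave p (fifthCoord q) := by
  rw [dirDeriv_comp_clm fifthCoord (contDiff_planeWave p).differentiable_infty]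
  ext q
  have h1 : HasDerivAt (planeWave p)
      (planeWave p (fifthCoord q) * (2 * Real.pi * Complex.I * p * (1 : ℝ))) (fifthCoord q) := by
    have := ((hasDerivAt_id (fifthCoord q)).ofReal_comp.const_mul
      (2 * Real.pi * Complex.I * p : ℂ)).cexp
    exact this
  simp only [dirDeriv]
  rw [h1.hasFDerivAt.fderiv]
  simp
  ring

theorem dirDeriv_planeWave_mul (p : ℝ) {K : Mink4 → ℂ} (hK : ContDiff ℝ ∞ K) (v : Mink5) :
    dirDeriv v (fun q => planeWave p (fifthCoord q) * K (toMink4 q)) = fun q =>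
      2 * Real.pi * Complex.I * p * fifthCoord v * (planeWave p (fifthCoord q) * K (toMink4 q)) +
        planeWave p (fifthCoord q) * dirDeriv (toMink4 v) K (toMink4 q) := by
  have h1 : Differentiable ℝ fun q : Mink5 => planeWave p (fifthCoord q) :=
    ((contDiff_planeWave p).comp fifthCoord.contDiff).differentiable_infty
  have h2 : Differentiable ℝ fun q : Mink5 => K (toMink4 q) :=
    (hK.comp toMink4.contDiff).differentiable_infty
  rw [dirDeriv_mul h1 h2, dirDeriv_planeWave_fifthCoord,
    dirDeriv_comp_clm toMink4 hK.differentiable_infty]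
  ext q
  ring

theorem contDiff_planeWave_mul (p : ℝ) {K : Mink4 → ℂ} (hK : ContDiff ℝ ∞ K) :
    ContDiff ℝ ∞ fun q => planeWave p (fifthCoord q) * K (toMink4 q) :=
  ((contDiff_planeWave p).comp fifthCoord.contDiff).mul (hK.comp toMink4.contDiff)

/-- The plane wave is constant in the directions of `𝓜`, while its second `z`-derivative multiplies
by `-(2πp)²`: fifth momentum acts as additional squared mass. -/
theorem dAlembertian_planeWave_mul (p : ℝ) {K : Mink4 → ℂ} (hK : ContDiff ℝ ∞ K) (q : Mink5) :
    dAlembertian (fun q => planeWave p (fifthCoord q) * K (toMink4 q)) q =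
      planeWave p (fifthCoord q) *
        (dAlembertian K (toMink4 q) - ((2 * Real.pi * p) ^ 2 : ℝ) * K (toMink4 q)) := by
  let b := stdOrthonormalBasis ℝ Space3
  have hh : ∀ v : Mink5, fifthCoord v = 0 →
      dirDeriv v (dirDeriv v fun q => planeWave p (fifthCoord q) * K (toMink4 q)) q =
      planeWave p (fifthCoord q) *
        dirDeriv (toMink4 v) (dirDeriv (toMink4 v) K) (toMink4 q) := by
    intro v hv
    have h1 := dirDeriv_planeWave_mul p hK v
    simp only [hv, Complex.ofReal_zero, mul_zero, zero_mul, zero_add] at h1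
    have h2 := dirDeriv_planeWave_mul p (hK.dirDeriv (toMink4 v)) v
    simp only [hv, Complex.ofReal_zero, mul_zero, zero_mul, zero_add] at h2
    rw [h1, h2]
  have hz : dirDeriv (0, WithLp.toLp 2 (0, 1))
      (dirDeriv (0, WithLp.toLp 2 (0, 1)) fun q => planeWave p (fifthCoord q) * K (toMink4 q)) q =
      -((2 * Real.pi * p) ^ 2 : ℝ) * (planeWave p (fifthCoord q) * K (toMink4 q)) := by
    have e1 : toMink4 (0, WithLp.toLp 2 (0, 1)) = 0 := by simp [toMink4]
    have e2 : fifthCoord (0, WithLp.toLp 2 (0, 1)) = 1 := by simp [fifthCoord]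
    have e3 : dirDeriv (0 : Mink4) K = fun _ => 0 := by ext; simp [dirDeriv]
    have h1 := dirDeriv_planeWave_mul p hK (0, WithLp.toLp 2 (0, 1))
    simp only [e1, e2, e3, Complex.ofReal_one, mul_one, mul_zero, add_zero] at h1
    rw [h1, dirDeriv_const_mul (contDiff_planeWave_mul p hK).differentiable_infty, h1]
    push_cast
    linear_combination (4 * Real.pi ^ 2 * p ^ 2 * (planeWave p (fifthCoord q) * K (toMink4 q))) *
      Complex.I_sq
  rw [dAlembertian_eq (b.prod (OrthonormalBasis.singleton Unit ℝ)) (contDiff_planeWave_mul p hK),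
    dAlembertian_eq b hK, Fintype.sum_sum_type]
  simp only [OrthonormalBasis.prod_apply, Sum.elim_inl, Sum.elim_inr, Function.comp_apply,
    Finset.univ_unique, Finset.sum_singleton, OrthonormalBasis.singleton_apply,
    LinearMap.coe_inl, LinearMap.coe_inr]
  have et : toMink4 (1, 0) = (1, 0) := by simp [toMink4]
  have es : ∀ i, toMink4 (0, WithLp.toLp 2 (b i, 0)) = (0, b i) := fun i => by simp [toMink4]
  have hs := fun i => hh (0, WithLp.toLp 2 (b i, 0)) (by simp [fifthCoord])
  have ht := hh (1, 0) (by simp [fifthCoord])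
  simp only [es] at hs
  rw [et] at ht
  rw [ht, hz, Finset.sum_congr rfl fun i _ => hs i, ← Finset.mul_sum]
  ring

end PlaneWave

/-! ### The five-dimensional propagator as a superposition of modes -/

section FiveDimensional

open SchwartzMap

/-- The squared mass `4m² + (2πp)²` of the mode with fifth momentum `2πp`. -/
def modeMass (m p : ℝ) : ℝ := 4 * m ^ 2 + (2 * Real.pi * p) ^ 2

theorem le_modeMass (m p : ℝ) : 4 * m ^ 2 ≤ modeMass m p := le_add_of_nonneg_right (sq_nonneg _)

theorem modeMass_pos {m : ℝ} (hm : 0 < m) (p : ℝ) : 0 < modeMass m p :=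
  lt_of_lt_of_le (by positivity) (le_modeMass m p)

theorem continuous_modeMass (m : ℝ) : Continuous (modeMass m) := by unfold modeMass; fun_prop

/-- The mode `(x, z) ↦ e^{2πipz} G_ret^{4m² + (2πp)²}(φ)(x)`. -/
def retardedMode (m : ℝ) (φ : Mink4 → ℂ) (p : ℝ) (q : Mink5) : ℂ :=
  planeWave p (fifthCoord q) * retardedPropagator (modeMass m p) φ (toMink4 q)

theorem contDiff_retardedMode {m : ℝ} (hm : 0 < m) {φ : Mink4 → ℂ} (hφ : IsPastCompactSmooth φ)
    (p : ℝ) : ContDiff ℝ ∞ (retardedMode m φ p) :=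
  contDiff_planeWave_mul p (hφ.isRetardedSolution_retardedPropagator (modeMass_pos hm p)).1.1

theorem continuous_retardedMode_left {m : ℝ} (hm : 0 < m) {φ : Mink4 → ℂ}
    (hφ : IsPastCompactSmooth φ) (q : Mink5) : Continuous fun p => retardedMode m φ p q :=
  (continuous_planeWave_left _).mul ((continuousOn_retardedPropagator hφ _).comp_continuous
    (continuous_modeMass m) fun p => modeMass_pos hm p)

theorem norm_retardedMode (m : ℝ) (φ : Mink4 → ℂ) (p : ℝ) (q : Mink5) :
    ‖retardedMode m φ p q‖ = ‖retardedPropagator (modeMass m p) φ (toMink4 q)‖ := by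
  rw [retardedMode, norm_mul, norm_planeWave, one_mul]

theorem retardedMode_locally_le_div {m : ℝ} (hm : 0 < m) {φ : Mink4 → ℂ}
    (hφ : IsPastCompactSmooth φ) (q₀ : Mink5) : ∃ U ∈ 𝓝 q₀, ∃ C : ℝ, 0 ≤ C ∧
      ∀ p, ∀ q ∈ U, ‖retardedMode m φ p q‖ ≤ C / modeMass m p := by
  obtain ⟨U, hU, C, hC0, hC⟩ := retardedPropagator_locally_le_div hφ (toMink4 q₀)
  refine ⟨toMink4 ⁻¹' U, toMink4.continuous.continuousAt hU, C, hC0, fun p q hq => ?_⟩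
  rw [norm_retardedMode]
  exact hC _ (modeMass_pos hm p) _ hq

theorem memLp_inv_modeMass {m : ℝ} (hm : 0 < m) (C : ℝ) :
    MemLp (fun p => C / modeMass m p) 2 (volume : Measure ℝ) := by
  have hc : Continuous fun p => C / modeMass m p :=
    continuous_const.div (continuous_modeMass m) fun p => (modeMass_pos hm p).ne'
  rw [memLp_two_iff_integrable_sq hc.aestronglyMeasurable]
  obtain ⟨k, hk, hk1⟩ : ∃ k : ℝ, 0 < k ∧ ∀ p, k * (1 + p ^ 2) ≤ modeMass m p := by
    -- The constant term of `modeMass` is `4m²`, and the coefficient of `p²` is `(2π)² ≥ 1`.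
    refine ⟨min (4 * m ^ 2) 1, lt_min (by positivity) one_pos, fun p => ?_⟩
    have h1 : min (4 * m ^ 2) 1 ≤ 4 * m ^ 2 := min_le_left _ _
    have h2 : min (4 * m ^ 2) 1 ≤ 1 := min_le_right _ _
    have h3 : (1 : ℝ) ≤ (2 * Real.pi) ^ 2 := by nlinarith [Real.pi_gt_three]
    unfold modeMass
    nlinarith [sq_nonneg p, mul_le_mul_of_nonneg_right h2 (sq_nonneg p),
      mul_le_mul_of_nonneg_right h3 (sq_nonneg p)]
  refine (integrable_inv_one_add_sq.const_mul (C ^ 2 / k ^ 2)).mono'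
    (hc.pow 2).aestronglyMeasurable (Eventually.of_forall fun p => ?_)
  rw [Real.norm_of_nonneg (sq_nonneg _), div_pow, div_mul_eq_mul_div, mul_div_assoc,
    div_eq_mul_inv (C ^ 2)]
  refine mul_le_mul_of_nonneg_left ?_ (sq_nonneg C)
  rw [← one_div, ← one_div, div_div, one_div, one_div]
  refine inv_anti₀ (by positivity) ?_
  have h4 : 1 ≤ 1 + p ^ 2 := by nlinarith [sq_nonneg p]
  calc (1 + p ^ 2) * k ^ 2 ≤ (1 + p ^ 2) ^ 2 * k ^ 2 :=
        mul_le_mul_of_nonneg_right (le_self_pow₀ h4 two_ne_zero) (sq_nonneg k)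
    _ = (k * (1 + p ^ 2)) ^ 2 := by ring
    _ ≤ _ := pow_le_pow_left₀ (by positivity) (hk1 p) 2

theorem memLp_retardedMode {m : ℝ} (hm : 0 < m) {φ : Mink4 → ℂ} (hφ : IsPastCompactSmooth φ)
    (q : Mink5) : MemLp (fun p => retardedMode m φ p q) 2 (volume : Measure ℝ) := by
  obtain ⟨U, hU, C, hC0, hC⟩ := retardedMode_locally_le_div hm hφ q
  refine (memLp_inv_modeMass hm C).of_le
    (continuous_retardedMode_left hm hφ q).aestronglyMeasurable (Eventually.of_forall fun p => ?_)
  exact (hC p q (mem_of_mem_nhds hU)).trans (le_abs_self _)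

/-- Continuous functions on the line all of whose moments are integrable. -/
def HasIntegrableMoments (a : ℝ → ℂ) : Prop :=
  Continuous a ∧ ∀ k : ℕ, Integrable fun p : ℝ => (p : ℂ) ^ k * a p

theorem HasIntegrableMoments.mul_id {a : ℝ → ℂ} (ha : HasIntegrableMoments a) (c : ℂ) :
    HasIntegrableMoments fun p => c * p * a p := by
  refine ⟨(continuous_const.mul Complex.continuous_ofReal).mul ha.1, fun k => ?_⟩
  refine ((ha.2 (k + 1)).const_mul c).congr (Eventually.of_forall fun p => ?_)
  simp only
  ring

theorem hasIntegrableMoments_schwartzMap (f : 𝓢(ℝ, ℂ)) : HasIntegrableMoments f := by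
  refine ⟨f.continuous, fun k => ?_⟩
  refine (f.integrable_pow_mul volume k).mono'
    ((Complex.continuous_ofReal.pow k).mul f.continuous).aestronglyMeasurable
    (Eventually.of_forall fun p => ?_)
  simp

/-- The product rule gives two terms: one brings a factor `p` down from the plane wave, the other
differentiates the source. Amplitudes with all moments integrable are stable under the first. -/
theorem isDerivClosed_retardedMode {m : ℝ} (hm : 0 < m) :
    IsDerivClosed (volume : Measure ℝ)
      (fun (i : {a // HasIntegrableMoments a} × {φ : Mink4 → ℂ // IsPastCompactSmooth φ}) (p : ℝ)
        (q : Mink5) => i.1.1 p * retardedMode m i.2.1 p q) := by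
  refine ⟨fun i => Eventually.of_forall fun p => ?_, fun i q => ?_, fun i q => ?_, fun i v => ?_⟩
  · exact contDiff_const.mul (contDiff_retardedMode hm i.2.2 p)
  · exact (i.1.2.1.mul (continuous_retardedMode_left hm i.2.2 q)).aestronglyMeasurable
  · obtain ⟨U, hU, C, hC0, hC⟩ := retardedMode_locally_le_div hm i.2.2 q
    have hi : Integrable i.1.1 := by simpa using i.1.2.2 0
    refine ⟨U, hU, fun p => ‖i.1.1 p‖ * (C / (4 * m ^ 2)), hi.norm.mul_const _,
      Eventually.of_forall fun p y hy => ?_⟩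
    rw [norm_mul]
    exact mul_le_mul_of_nonneg_left ((hC p y hy).trans
      (div_le_div_of_nonneg_left hC0 (by positivity) (le_modeMass m p))) (norm_nonneg _)
  · refine ⟨⟨⟨_, i.1.2.mul_id (2 * Real.pi * Complex.I * fifthCoord v)⟩, i.2⟩,
      ⟨i.1, ⟨_, i.2.2.dirDeriv (toMink4 v)⟩⟩, Eventually.of_forall fun p => ?_⟩
    have hM := modeMass_pos hm p
    rw [dirDeriv_const_mul (contDiff_retardedMode hm i.2.2 p).differentiable_infty]
    have h1 := dirDeriv_planeWave_mul p
      (i.2.2.isRetardedSolution_retardedPropagator hM).1.1 v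
    ext q
    have h2 := congrFun h1 q
    rw [dirDeriv_retardedPropagator i.2.2 hM] at h2
    change _ * dirDeriv v (fun q => planeWave p (fifthCoord q) *
      retardedPropagator (modeMass m p) i.2.1 (toMink4 q)) q = _
    rw [h2]
    simp only [retardedMode]
    ring

theorem kleinGordon_retardedMode {m : ℝ} (hm : 0 < m) {φ : Mink4 → ℂ}
    (hφ : IsPastCompactSmooth φ) (p : ℝ) (q : Mink5) :
    dAlembertian (retardedMode m φ p) q - (4 * m ^ 2 : ℝ) * retardedMode m φ p q =
      planeWave p (fifthCoord q) * φ (toMink4 q) := by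
  have h := hφ.isRetardedSolution_retardedPropagator (modeMass_pos hm p)
  have h1 := dAlembertian_planeWave_mul p h.1.1 q
  have h2 := h.2 (toMink4 q)
  change dAlembertian (fun q => planeWave p (fifthCoord q) *
    retardedPropagator (modeMass m p) φ (toMink4 q)) q - _ * (_ * _) = _
  rw [h1, ← h2]
  simp only [modeMass]
  push_cast
  ring

/-- Each mode solves the equation with source `φ(x) e^{2πipz}`; integrating against `𝓕 h`, Fourier
inversion restores `h`. Past-compactness survives because the vanishing time of `G^M(φ)` does not
depend on `M`. -/
theorem isRetardedSolution_integral_retardedMode {m : ℝ} (hm : 0 < m) {φ : Mink4 → ℂ}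
    (hφ : IsPastCompactSmooth φ) (h : 𝓢(ℝ, ℂ)) :
    IsRetardedSolution (4 * m ^ 2) (tensorFun φ h) fun q => ∫ p, 𝓕 h p * retardedMode m φ p q := by
  have hcl := isDerivClosed_retardedMode hm
  let i : {a // HasIntegrableMoments a} × {φ : Mink4 → ℂ // IsPastCompactSmooth φ} :=
    (⟨_, hasIntegrableMoments_schwartzMap (𝓕 h)⟩, ⟨φ, hφ⟩)
  refine ⟨isPastCompactSmooth_iff.2 ⟨hcl.contDiff_integral i, fun P => ?_⟩, fun q => ?_⟩
  · obtain ⟨T, hT⟩ := exists_retardedPropagator_eq_zero hφ (toMink4 P)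
    refine ⟨T, fun q hq hlt => integral_eq_zero_of_ae (Eventually.of_forall fun p => ?_)⟩
    simp [retardedMode, hT _ (modeMass_pos hm p) _ (toMink4_mem_causalPast hq) hlt]
  · have hS : ∀ p, dAlembertian (fun q => 𝓕 h p * retardedMode m φ p q) q =
        𝓕 h p * dAlembertian (retardedMode m φ p) q := fun p =>
      dAlembertian_const_mul (contDiff_retardedMode hm hφ p) _ q
    have e1 := hcl.dAlembertian_integral i q
    have e2 := hcl.integrable i q
    simp only [i] at e1 e2
    have e3 : Integrable fun p => 𝓕 h p * planeWave p (fifthCoord q) * φ (toMink4 q) := by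
      refine Integrable.mul_const ?_ _
      refine (𝓕 h).integrable.norm.mono' ((𝓕 h).continuous.mul
        (continuous_planeWave_left _)).aestronglyMeasurable (Eventually.of_forall fun p => ?_)
      rw [norm_mul, norm_planeWave, mul_one]
    have e4 : ∀ p, 𝓕 h p * dAlembertian (retardedMode m φ p) q =
        𝓕 h p * planeWave p (fifthCoord q) * φ (toMink4 q) +
          (4 * m ^ 2 : ℝ) * (𝓕 h p * retardedMode m φ p q) := fun p => by
      rw [mul_assoc, ← kleinGordon_retardedMode hm hφ p q]; ring
    rw [e1]
    simp only [hS, e4]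
    rw [integral_add e3 (e2.const_mul _), integral_const_mul, add_sub_cancel_right,
      integral_mul_const, tensorFun_eq, mul_comm]
    congr 1
    have h5 : (𝓕⁻ (𝓕 h) : 𝓢(ℝ, ℂ)) (fifthCoord q) = h (fifthCoord q) := by
      rw [FourierTransform.fourierInv_fourier_eq]
    rw [fourierInv_coe, Real.fourierInv_eq'] at h5
    rw [← h5]
    refine integral_congr_ae (Eventually.of_forall fun p => ?_)
    simp only [planeWave, smul_eq_mul, RCLike.inner_apply, conj_trivial]
    rw [mul_comm]
    congr 2
    push_cast
    ring

theorem retardedPropagator_tensorFun {m : ℝ} (hm : 0 < m) {φ : Mink4 → ℂ}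
    (hφ : IsPastCompactSmooth φ) (h : 𝓢(ℝ, ℂ)) (q : Mink5) :
    retardedPropagator (4 * m ^ 2) (tensorFun φ h) q = ∫ p, 𝓕 h p * retardedMode m φ p q :=
  (congrFun ((isRetardedSolution_integral_retardedMode hm hφ h).eq_retardedPropagator
    (isPastCompactSmooth_tensorFun hφ (h.smooth ⊤)) (by positivity)) q).symm

end FiveDimensional

/-! ### Extension to `L²` and reduction to the mass integral -/

section L2Extension

open SchwartzMap

/-- This is the density of test functions in `L²`; it makes the limit defining the extension unique.
-/
theorem neBot_testFunNhds (g : Lp ℂ 2 (volume : Measure ℝ)) : (testFunNhds g).NeBot := by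
  rw [testFunNhds, inf_principal_neBot_iff]
  rintro U ⟨t, ht, htU⟩
  obtain ⟨ε, hε, hεt⟩ := (ENNReal.nhds_zero_basis_Iic.mem_iff).1 ht
  obtain ⟨δ, hδ, hδε⟩ : ∃ δ : ℝ, 0 < δ ∧ ENNReal.ofReal δ ≤ ε := by
    rcases eq_or_ne ε ⊤ with h | h
    · exact ⟨1, one_pos, h ▸ le_top⟩
    · exact ⟨ε.toReal, ENNReal.toReal_pos hε.ne' h, (ENNReal.ofReal_toReal h).le⟩
  obtain ⟨f, hf1, hf2, hf3⟩ := MemLp.exist_eLpNorm_sub_le (by norm_num) (by norm_num)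
    (Lp.memLp g) hδ
  refine ⟨f, htU (hεt ?_), hf2, hf1⟩
  have : eLpNorm (fun z => f z - g z) 2 volume = eLpNorm (⇑g - f) 2 volume := eLpNorm_sub_comm _ _ _ _
  exact mem_Iic.2 (this.trans_le (hf3.trans hδε))

/-- The limit in `testFunNhds g` of the values of the five-dimensional propagator. -/
theorem tendsto_retardedPropagator_tensorFun {m : ℝ} (hm : 0 < m) {φ : Mink4 → ℂ}
    (hφ : IsPastCompactSmooth φ) (g : Lp ℂ 2 (volume : Measure ℝ)) (q : Mink5) :
    Tendsto (fun h => retardedPropagator (4 * m ^ 2) (tensorFun φ h) q) (testFunNhds g)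
      (𝓝 (∫ p, (𝓕 g : Lp ℂ 2 (volume : Measure ℝ)) p * retardedMode m φ p q)) := by
  classical
  have hκ : MemLp (fun p => (starRingEnd ℂ) (retardedMode m φ p q)) 2 (volume : Measure ℝ) :=
    (memLp_retardedMode hm hφ q).star
  -- Conjugating the mode makes the pairing with it an `L²` inner product, hence continuous.
  let κ := hκ.toLp
  have hinner : ∀ f : Lp ℂ 2 (volume : Measure ℝ),
      inner ℂ κ f = ∫ p, f p * retardedMode m φ p q := by
    intro f
    rw [L2.inner_def]
    refine integral_congr_ae ?_
    filter_upwards [hκ.coeFn_toLp] with p hp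
    simp only [κ]
    rw [hp, RCLike.inner_apply, RCLike.conj_conj]
  -- The value `0` outside `L²` is immaterial: test functions are square integrable, and they are
  -- eventually all that the filter sees.
  let H : (ℝ → ℂ) → Lp ℂ 2 (volume : Measure ℝ) := fun h =>
    if hh : MemLp h 2 (volume : Measure ℝ) then hh.toLp h else 0
  have hmem : ∀ᶠ h in testFunNhds g, ContDiff ℝ ∞ h ∧ HasCompactSupport h :=
    (mem_principal_self _ : _ ∈ 𝓟 _) |> fun h => mem_inf_of_right h
  have hH : Tendsto H (testFunNhds g) (𝓝 g) := by
    rw [tendsto_iff_edist_tendsto_0]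
    have h1 : Tendsto (fun h : ℝ → ℂ => eLpNorm (fun z => h z - g z) 2 volume) (testFunNhds g)
        (𝓝 0) := tendsto_comap.mono_left inf_le_left
    refine h1.congr' ?_
    filter_upwards [hmem] with h hh
    have hL : MemLp h 2 (volume : Measure ℝ) := hh.1.continuous.memLp_of_hasCompactSupport hh.2
    simp only [H, dif_pos hL]
    rw [Lp.edist_def]
    refine eLpNorm_congr_ae ?_
    filter_upwards [hL.coeFn_toLp] with z hz
    simp [hz]
  have hlim : Tendsto (fun h => inner ℂ κ (𝓕 (H h) : Lp ℂ 2 (volume : Measure ℝ)))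
      (testFunNhds g) (𝓝 (inner ℂ κ (𝓕 g : Lp ℂ 2 (volume : Measure ℝ)))) := by
    have hc : Continuous fun f : Lp ℂ 2 (volume : Measure ℝ) =>
        inner ℂ κ (𝓕 f : Lp ℂ 2 (volume : Measure ℝ)) :=
      continuous_const.inner (FourierTransform.continuous_fourier)
    exact (hc.tendsto g).comp hH
  rw [hinner] at hlim
  refine hlim.congr' ?_
  filter_upwards [hmem] with h hh
  have hL : MemLp h 2 (volume : Measure ℝ) := hh.1.continuous.memLp_of_hasCompactSupport hh.2
  let S : 𝓢(ℝ, ℂ) := hh.2.toSchwartzMap hh.1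
  have hS : H h = S.toLp 2 volume := by
    simp only [H, dif_pos hL]
    rfl
  have hT : retardedPropagator (4 * m ^ 2) (tensorFun φ h) q = ∫ p, 𝓕 S p * retardedMode m φ p q :=
    retardedPropagator_tensorFun hm hφ S q
  rw [hT, hS, SchwartzMap.toLp_fourier_eq, hinner]
  refine integral_congr_ae ?_
  filter_upwards [(𝓕 S).coeFn_toLp 2 volume] with p hp
  rw [hp]

/-- The integral over the modes which represents `G_ret(φ ⊗ ρ̌)`. -/
def modeIntegral (m : ℝ) (φ : Mink4 → ℂ) (q : Mink5) : ℂ :=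
  ∫ p : ℝ, ((2 * Real.pi * rhoSymbol m (2 * Real.pi * p) : ℝ) : ℂ) * retardedMode m φ p q

theorem tendsto_modeIntegral {m : ℝ} (hm : 0 < m) {φ : Mink4 → ℂ} (hφ : IsPastCompactSmooth φ)
    (q : Mink5) : Tendsto (fun h => retardedPropagator (4 * m ^ 2) (tensorFun φ h) q)
      (testFunNhds (rhoCheck m hm)) (𝓝 (modeIntegral m φ q)) := by
  have h1 := tendsto_retardedPropagator_tensorFun hm hφ (rhoCheck m hm) q
  convert h1 using 2
  rw [rhoCheck, FourierTransform.fourier_fourierInv_eq, modeIntegral]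
  refine integral_congr_ae ?_
  filter_upwards [(memLp_rhoSymbol hm).coeFn_toLp] with p hp
  rw [hp]

theorem retardedPropagatorL2_rhoCheck {m : ℝ} (hm : 0 < m) {φ : Mink4 → ℂ}
    (hφ : IsPastCompactSmooth φ) :
    retardedPropagatorL2 (4 * m ^ 2) φ (rhoCheck m hm) = modeIntegral m φ := by
  ext q
  have := neBot_testFunNhds (rhoCheck m hm)
  exact (tendsto_modeIntegral hm hφ q).limUnder_eq

/-- Near a point the integrand is dominated by the symbol times `C / modeMass`, a product of two
`L²` functions of `p`. -/
theorem continuous_modeIntegral {m : ℝ} (hm : 0 < m) {φ : Mink4 → ℂ}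
    (hφ : IsPastCompactSmooth φ) : Continuous (modeIntegral m φ) := by
  rw [continuous_iff_continuousAt]
  intro q₀
  obtain ⟨U, hU, C, hC0, hC⟩ := retardedMode_locally_le_div hm hφ q₀
  have hs := memLp_rhoSymbol hm
  refine continuousAt_of_dominated (bound := fun p =>
    ‖((2 * Real.pi * rhoSymbol m (2 * Real.pi * p) : ℝ) : ℂ)‖ * (C / modeMass m p)) ?_ ?_ ?_ ?_
  · exact Eventually.of_forall fun q =>
      hs.1.mul (continuous_retardedMode_left hm hφ q).aestronglyMeasurable
  · filter_upwards [hU] with q hq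
    filter_upwards with p
    rw [norm_mul]
    exact mul_le_mul_of_nonneg_left (hC p q hq) (norm_nonneg _)
  · exact hs.norm.integrable_mul (memLp_inv_modeMass hm C)
  · filter_upwards with p
    exact (continuous_const.mul (contDiff_retardedMode hm hφ p).continuous).continuousAt

theorem integral_complex_comp_abs {f : ℝ → ℂ} :
    ∫ x, f |x| = 2 * ∫ x in Ioi (0 : ℝ), f x := by
  have eq : ∫ (x : ℝ) in Ioi 0, f |x| = ∫ (x : ℝ) in Ioi 0, f x := by
    refine setIntegral_congr_fun measurableSet_Ioi (fun _ hx => ?_)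
    rw [abs_eq_self.mpr (le_of_lt (by exact hx))]
  by_cases hf : IntegrableOn (fun x => f |x|) (Ioi 0)
  · have int_Iic : IntegrableOn (fun x ↦ f |x|) (Iic 0) := by
      rw [← Measure.map_neg_eq_self (volume : Measure ℝ)]
      let m : MeasurableEmbedding fun x : ℝ => -x := (Homeomorph.neg ℝ).measurableEmbedding
      rw [m.integrableOn_map_iff]
      simp_rw [Function.comp_def, abs_neg, neg_preimage, neg_Iic, neg_zero]
      exact Iff.mpr integrableOn_Ici_iff_integrableOn_Ioi hf
    calc
      _ = (∫ x in Iic 0, f |x|) + ∫ x in Ioi 0, f |x| := by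
        rw [← setIntegral_union (Iic_disjoint_Ioi le_rfl) measurableSet_Ioi int_Iic hf,
          Iic_union_Ioi, Measure.restrict_univ]
      _ = 2 * ∫ x in Ioi 0, f x := by
        rw [two_mul, eq]
        congr! 1
        rw [← neg_zero, ← integral_comp_neg_Iic, neg_zero]
        refine setIntegral_congr_fun measurableSet_Iic (fun _ hx => ?_)
        rw [abs_eq_neg_self.mpr (by exact hx)]
  · have : ¬ Integrable (fun x => f |x|) := by
      contrapose hf
      exact hf.integrableOn
    -- Without integrability both integrals take the default value `0`.
    rw [← eq, integral_undef hf, integral_undef this, mul_zero]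

theorem modeIntegral_event5 {m : ℝ} (φ : Mink4 → ℂ) (x : Mink4) :
    modeIntegral m φ (event5 x 0) = spectralIntegral m φ x := by
  have e1 : toMink4 (event5 x 0) = x := rfl
  have e2 : fifthCoord (event5 x 0) = 0 := rfl
  let k : ℝ → ℂ := fun r => (rhoSymbol m r : ℂ) * retardedPropagator (r ^ 2 + 4 * m ^ 2) φ x
  have h1 : modeIntegral m φ (event5 x 0) = (2 * Real.pi : ℝ) • ∫ p, k (2 * Real.pi * p) := by
    rw [modeIntegral, ← integral_smul]
    refine integral_congr_ae (Eventually.of_forall fun p => ?_)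
    simp only [retardedMode, e1, e2, k, planeWave, modeMass, Complex.real_smul]
    rw [add_comm (4 * m ^ 2)]
    push_cast
    simp
    ring
  -- The Jacobian of `r = 2πp` absorbs the prefactor `2π`.
  have h2 : modeIntegral m φ (event5 x 0) = ∫ r, k r := by
    rw [h1, Measure.integral_comp_mul_left, smul_smul, abs_of_pos (by positivity),
      mul_inv_cancel₀ (by positivity), one_smul]
  have h3 : ∀ r, k r = k |r| := fun r => by simp [k, rhoSymbol]
  rw [h2, integral_congr_ae (Eventually.of_forall h3), integral_complex_comp_abs]
  have himg : (fun r : ℝ => r ^ 2 + 4 * m ^ 2) '' Ioi 0 = Ioi (4 * m ^ 2) := by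
    ext M
    constructor
    · rintro ⟨r, hr, rfl⟩
      have : (0 : ℝ) < r ^ 2 := pow_pos hr 2
      exact lt_add_of_pos_left _ this
    · intro hM
      have : 0 < M - 4 * m ^ 2 := sub_pos.2 hM
      refine ⟨√(M - 4 * m ^ 2), Real.sqrt_pos.2 this, ?_⟩
      simp only [Real.sq_sqrt this.le, sub_add_cancel]
  -- With `M = r² + 4m²` one has `dM = 2r dr`: the `r` is the `|p|` of `rhoSymbol`, and the `2`
  -- comes from folding the even integrand.
  have hcv := integral_image_eq_integral_abs_deriv_smul (s := Ioi (0 : ℝ))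
    (f := fun r => r ^ 2 + 4 * m ^ 2) (f' := fun r => 2 * r) measurableSet_Ioi
    (fun r _ => by
      have := ((hasDerivAt_pow 2 r).add_const (4 * m ^ 2)).hasDerivWithinAt (s := Ioi 0)
      simpa using this)
    (fun r hr s hs hrs => by
      have : r ^ 2 = s ^ 2 := by simpa using hrs
      exact (pow_left_inj₀ (le_of_lt hr) (le_of_lt hs) two_ne_zero).1 this)
    (fun M => (rhoDensity m M : ℂ) * retardedPropagator M φ x)
  rw [himg] at hcv
  rw [spectralIntegral, hcv, ← integral_const_mul]
  refine setIntegral_congr_fun measurableSet_Ioi fun r hr => ?_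
  simp only [k, rhoSymbol, Complex.real_smul, abs_of_pos (mul_pos two_pos (mem_Ioi.1 hr)),
    abs_of_pos (mem_Ioi.1 hr)]
  push_cast
  ring

end L2Extension

end

theorem mainTheorem12 (m : ℝ) (hm : 0 < m) (φ : Mink4 → ℂ) (hφ : IsPastCompactSmooth φ) :
    -- the propagators are well defined on the sources on which they are evaluated
    (∀ M : ℝ, 4 * m ^ 2 ≤ M → ∃! ψ, IsRetardedSolution M φ ψ) ∧
    (∀ h : ℝ → ℂ, ContDiff ℝ ∞ h → HasCompactSupport h →
      ∃! Ψ, IsRetardedSolution (4 * m ^ 2) (tensorFun φ h) Ψ) ∧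
    -- the extension of the five-dimensional propagator is well defined and continuous at `φ ⊗ ρ̌`
    (testFunNhds (rhoCheck m hm)).NeBot ∧
    (∀ q : Mink5, Tendsto (fun h => retardedPropagator (4 * m ^ 2) (tensorFun φ h) q)
      (testFunNhds (rhoCheck m hm))
      (𝓝 (retardedPropagatorL2 (4 * m ^ 2) φ (rhoCheck m hm) q))) ∧
    Continuous (retardedPropagatorL2 (4 * m ^ 2) φ (rhoCheck m hm)) ∧
    -- the integral over the masses converges absolutely, to a past-compact smooth function
    (∀ p : Mink4, IntegrableOn
      (fun M : ℝ => (rhoDensity m M : ℂ) * retardedPropagator M φ p) (Ioi (4 * m ^ 2)) volume) ∧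
    IsPastCompactSmooth (spectralIntegral m φ) ∧
    -- the two identities
    spectralIntegral m φ =
      restrictZero (retardedPropagatorL2 (4 * m ^ 2) φ (rhoCheck m hm)) ∧
    IsPastCompactSmooth (dAlembertian φ) ∧
    nonlocalK0 m φ =
      restrictZero (retardedPropagatorL2 (4 * m ^ 2) (dAlembertian φ) (rhoCheck m hm)) := by
  have h4 : (0 : ℝ) < 4 * m ^ 2 := by positivity
  have key : ∀ φ, IsPastCompactSmooth φ → spectralIntegral m φ =
      restrictZero (retardedPropagatorL2 (4 * m ^ 2) φ (rhoCheck m hm)) := fun φ hφ => by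
    rw [retardedPropagatorL2_rhoCheck hm hφ]
    ext x
    exact (modeIntegral_event5 φ x).symm
  refine ⟨fun M hM => hφ.existsUnique_isRetardedSolution (h4.trans_le hM),
    fun h hh _ => (isPastCompactSmooth_tensorFun hφ hh).existsUnique_isRetardedSolution h4,
    neBot_testFunNhds _, fun q => ?_, ?_,
    fun p => (isDerivClosed_spectral hm).integrable ⟨φ, hφ⟩ p,
    isPastCompactSmooth_spectralIntegral hm hφ, key φ hφ, hφ.dAlembertian, ?_⟩
  · rw [retardedPropagatorL2_rhoCheck hm hφ]
    exact tendsto_modeIntegral hm hφ q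
  · rw [retardedPropagatorL2_rhoCheck hm hφ]
    exact continuous_modeIntegral hm hφ
  · rw [nonlocalK0_eq_spectralIntegral hm hφ]
    exact key _ hφ.dAlembertian
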